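/- **Setting.** Let $d,k\ge 1$. Let $L$ be the vertex set of the semi-infinite Cayley tree of order $k$: the root is the empty word $(0)$, the vertices of level $n$ are the words $(i_1,\dots,i_n)\in\{1,\dots,k\}^n$, and the direct successors of $x$ are $(x,1),\dots,(x,k)$. Let $W_n$ be the set of vertices of level $n$, in lexicographic order, $\Lambda_n=W_0\cup\dots\cup W_n$ and $\Lambda_n^c:=\bigcup_{m\ge n}W_m$. For finite $\Lambda\subset L$ put $\mathcal B_\Lambda=\bigotimes_{x\in\Lambda}M_d(\mathbb C)$, let $\mathcal B_L$ be the $C^*$-inductive limit of these algebras, and for arbitrary $X\subseteq L$ let $\mathcal B_X\subseteq\mathcal B_L$ be the $C^*$-subalgebra generated by the $\mathcal B_\Lambda$, $\Lambda\subseteq X$ finite. Write $\mathrm{tr}$ for the normalized trace and $\mathrm{tr}_X$ for the normalized partial trace onto $\mathcal B_X$. For each edge $\langle x,y\rangle$, $y=(x,i)$, let $K_{\langle x,y\rangle}\in\mathcal B_{\{x,y\}}$ be arbitrary. Let $w_0\in\mathcal B_{(0)}$, $w_0\ge0$, and $h_x\in\mathcal B_{\{x\}}$, $h_x\ge 0$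 $(x\in L)$; write $h_0$ for $h_x$ at the root. All products are taken in the order above ($\overrightarrow{S(x)}$: direct successors in increasing order, $\overleftarrow{S(x)}$: in decreasing order). Put $$K_{[m-1,m]}=\prod_{x\in \overrightarrow{W}_{m-1}}\prod_{y\in\overrightarrow{S(x)}}K_{\langle x,y\rangle},\qquad K_n=w_0^{1/2}K_{[0,1]}\cdots K_{[n-1,n]}\prod_{x\in\overrightarrow{W}_n}h_x^{1/2},\qquad \mathcal W_{n]}=K_nK_n^*,$$ $$\varphi^{(n,f)}_{w_0,\mathbf h}(a)=\mathrm{tr}\big(\mathcal W_{n+1]}(a\otimes 1_{W_{n+1}})\big),\qquad a\in\mathcal B_{\Lambda_n}.$$ A *quasi-conditional expectation* with respect to unital $C^*$-algebras $\mathcal C\subseteq\mathcal B\subseteq\mathcal A$ is a completely positive linear map $\mathcal E:\mathcal A\to\mathcal B$ with $\mathcal E(1)=1$ and $\mathcal E(ca)=c\,\mathcal E(a)$ for $c\in\mathcal C$, $a\in\mathcal A$. A state $\varphi$ on $\mathcal B_L$ is a *forward quantum $d$-Markov chain* given by $(\mathcal E_n)_{n\ge1}$ and $(\hat\varphi_n)_{n\ge0}$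 if each $\mathcal E_n$ is a quasi-conditional expectation with respect to $\mathcal B_{\Lambda_{n+1}^c}\subseteq\mathcal B_{\Lambda_n^c}\subseteq\mathcal B_{\Lambda_{n-1}^c}$, each $\hat\varphi_n$ is a state on $\mathcal B_{\Lambda_n^c}$, $\hat\varphi_n$ and $\hat\varphi_{n+1}\circ\mathcal E_{n+1}$ coincide on $\mathcal B_{W_n\cup W_{n+1}}$ for every $n\ge 0$, and $\varphi=\lim_{n\to\infty}\hat\varphi_n\circ\mathcal E_n\circ\cdots\circ\mathcal E_1$ in the weak-$*$ topology. A state $\varphi$ on $\mathcal B_L$ is called the weak-$*$ limit of the functionals $\varphi^{(n,f)}_{w_0,\mathbf h}$ if $\varphi^{(n,f)}_{w_0,\mathbf h}(a)\to\varphi(a)$ for every $a$ in every $\mathcal B_{\Lambda_m}$ and if, moreover, $\psi_n\to\varphi$ in the weak-$*$ topology for all states $\psi_n$ on $\mathcal B_L$ that extend $\varphi^{(n,f)}_{w_0,\mathbf h}$. **Theorem.** Assume that $\mathrm{tr}(w_0h_0)=1$ and that for every $x\in L$ $$\mathrm{tr}_{\{x\}}\Big[\prod_{y\in\overrightarrow{S(x)}}K_{\langle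 x,y\rangle}\prod_{y\in\overrightarrow{S(x)}}h_y\prod_{y\in\overleftarrow{S(x)}}K_{\langle x,y\rangle}^*\Big]=h_x .$$ Then: 1. Every $\varphi^{(n,f)}_{w_0,\mathbf h}$ is a state, and the family is compatible: $\varphi^{(n+1,f)}_{w_0,\mathbf h}|_{\mathcal B_{\Lambda_n}}=\varphi^{(n,f)}_{w_0,\mathbf h}$ for all $n\ge0$. 2. There is a state $\varphi$ on $\mathcal B_L$ that is the weak-$*$ limit of the $\varphi^{(n,f)}_{w_0,\mathbf h}$; it is the only state with this property, and it is a forward quantum $d$-Markov chain. 3. In 2, the quasi-conditional expectations $\mathcal E_n$ can be chosen as follows. Put $T_n(a)=\mathrm{tr}_{\Lambda_n^c}\big(K_{[n-1,n]}^*\,a\,K_{[n-1,n]}\big)$ for $a\in\mathcal B_{\Lambda_{n-1}^c}$, $\rho_0=w_0$ and $\rho_n=T_n(\rho_{n-1})\in\mathcal B_{W_n}$. Then for all $n\ge1$ and $a\in\mathcal B_{\Lambda_{n-1}^c}$ $$\rho_n^{1/2}\,\mathcal E_n(a)\,\rho_n^{1/2}=T_n\big(\rho_{n-1}^{1/2}\,a\,\rho_{n-1}^{1/2}\big).$$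 -/

import Mathlib

open scoped CStarAlgebra ComplexOrder

noncomputable section

namespace QMC

/-! ### The tree -/

/-- Vertices of the semi-infinite Cayley tree of order `k`, in coordinates: the root is `[]`, the
vertex `(i₁, …, iₙ)` is the list `[i₁, …, iₙ]`, and its direct successors are the lists
`[i₁, …, iₙ, i]`.  The level (distance to the root) of a vertex is the length of the list, and the
edges are the pairs `⟨x, child x i⟩`. -/
abbrev Vertex (k : ℕ) : Type := List (Fin k)

variable {d k : ℕ}

/-- The direct successor `(x, i)` of `x`. -/
def child (x : Vertex k) (i : Fin k) : Vertex k := x ++ [i]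

/-- The direct successors of `x`, in their natural order. -/
def children (x : Vertex k) : List (Vertex k) := (List.finRange k).map (child x)

/-- The vertices of level `n`, in lexicographic order. -/
def level (k : ℕ) : ℕ → List (Vertex k)
  | 0 => [[]]
  | n + 1 => (level k n).flatMap children

/-- `W_n` as a finite set. -/
def sphere (k n : ℕ) : Finset (Vertex k) := (level k n).toFinset

/-- `Λ_n = W_0 ∪ ⋯ ∪ W_n` as a finite set. -/
def ball (k n : ℕ) : Finset (Vertex k) := (Finset.range (n + 1)).biUnion (sphere k)

theorem mem_level {n : ℕ} {x : Vertex k} : x ∈ level k n ↔ x.length = n := by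
  induction n generalizing x with
  | zero => simp [level]
  | succ n ih =>
    simp only [level, List.mem_flatMap, children, List.mem_map, List.mem_finRange, true_and, child]
    constructor
    · rintro ⟨y, hy, i, rfl⟩
      simp [ih.1 hy]
    · intro hx
      have hne : x ≠ [] := by rintro rfl; simp at hx
      exact ⟨x.dropLast, ih.2 (by simp [hx]), x.getLast hne, List.dropLast_append_getLast hne⟩

theorem mem_sphere {n : ℕ} {x : Vertex k} : x ∈ sphere k n ↔ x.length = n := by
  simp [sphere, mem_level]

theorem mem_ball {n : ℕ} {x : Vertex k} : x ∈ ball k n ↔ x.length ≤ n := by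
  simp [ball, mem_sphere]

/-! ### Local observables and the quasi-local algebra

`⨂_{x ∈ S} M_d` for a finite set `S` of vertices is the algebra of matrices indexed by the
configurations `S → Fin d`.  All these algebras act faithfully on `ℓ²` of the set of all
configurations of the tree, each by changing only the coordinates in `S`; the C⋆-inductive limit is
the norm closure of the union of their images. -/

/-- `⨂_{x ∈ S} M_d`. -/
abbrev Mat (d : ℕ) {k : ℕ} (S : Finset (Vertex k)) : Type :=
  Matrix (S → Fin d) (S → Fin d) ℂ

/-- Configurations on the whole tree. -/
abbrev Conf (d k : ℕ) : Type := Vertex k → Fin d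

/-- The Hilbert space `ℓ²` of the set of configurations. -/
def Hil (d k : ℕ) : Type := lp (fun _ : Conf d k => ℂ) 2

instance : NormedAddCommGroup (Hil d k) :=
  inferInstanceAs (NormedAddCommGroup (lp (fun _ : Conf d k => ℂ) 2))

instance : InnerProductSpace ℂ (Hil d k) :=
  inferInstanceAs (InnerProductSpace ℂ (lp (fun _ : Conf d k => ℂ) 2))

instance : CompleteSpace (Hil d k) :=
  inferInstanceAs (CompleteSpace (lp (fun _ : Conf d k => ℂ) 2))

/-- The coordinates of a vector. -/
def Hil.coord (ξ : Hil d k) : Conf d k → ℂ := (show lp (fun _ : Conf d k => ℂ) 2 from ξ).1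

instance : CoeFun (Hil d k) (fun _ => Conf d k → ℂ) := ⟨Hil.coord⟩

/-- The basis vector of a configuration. -/
def ket (σ : Conf d k) : Hil d k :=
  haveI := Classical.decEq (Conf d k)
  lp.single (E := fun _ : Conf d k => ℂ) 2 σ 1

@[ext] theorem Hil.ext {ξ η : Hil d k} (h : ∀ σ, ξ σ = η σ) : ξ = η :=
  lp.ext (funext h)

@[simp] theorem Hil.zero_apply (σ : Conf d k) : (0 : Hil d k) σ = 0 := rfl

@[simp] theorem Hil.add_apply (ξ η : Hil d k) (σ : Conf d k) : (ξ + η) σ = ξ σ + η σ := rfl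

@[simp] theorem Hil.smul_apply (c : ℂ) (ξ : Hil d k) (σ : Conf d k) : (c • ξ) σ = c * ξ σ := rfl

@[simp] theorem Hil.sum_apply {ι : Type*} (s : Finset ι) (f : ι → Hil d k) (σ : Conf d k) :
    (∑ i ∈ s, f i) σ = ∑ i ∈ s, f i σ := by
  classical
  induction s using Finset.induction_on with
  | empty => simp
  | insert a s ha ih => simp [Finset.sum_insert ha, ih]

theorem Hil.inner_eq (ξ η : Hil d k) : inner ℂ ξ η = ∑' σ, inner ℂ (ξ σ) (η σ) :=
  lp.inner_eq_tsum (𝕜 := ℂ) (G := fun _ : Conf d k => ℂ) ξ η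

/-- The bounded operators on it. -/
abbrev Op (d k : ℕ) : Type := Hil d k →L[ℂ] Hil d k

/-- The configuration equal to `i` on `S` and to `σ` off `S`. -/
def patch (S : Finset (Vertex k)) (i : S → Fin d) (σ : Conf d k) : Conf d k :=
  fun x => if h : x ∈ S then i ⟨x, h⟩ else σ x

@[simp] theorem restrict_patch (S : Finset (Vertex k)) (i : S → Fin d) (σ : Conf d k) :
    S.restrict (patch S i σ) = i := by
  funext x; simp [patch, x.2]

@[simp] theorem patch_patch (S : Finset (Vertex k)) (i j : S → Fin d) (σ : Conf d k) :
    patch S i (patch S j σ) = patch S i σ := by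
  funext x; by_cases h : x ∈ S <;> simp [patch, h]

@[simp] theorem patch_restrict (S : Finset (Vertex k)) (σ : Conf d k) :
    patch S (S.restrict σ) σ = σ := by
  funext x; simp [patch]

theorem patch_injOn (S : Finset (Vertex k)) (i j : S → Fin d) :
    Set.InjOn (patch S j) {σ : Conf d k | S.restrict σ = i} := by
  intro σ hσ τ hτ h
  rw [← patch_restrict S σ, ← patch_restrict S τ, show S.restrict σ = i from hσ,
    show S.restrict τ = i from hτ, ← patch_patch S i j σ, h, patch_patch]

theorem sum_unit_le (S : Finset (Vertex k)) (i j : S → Fin d) (ξ : Hil d k)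
    (s : Finset (Conf d k)) :
    ∑ σ ∈ s, ‖if S.restrict σ = i then ξ (patch S j σ) else 0‖ ^ (2 : ENNReal).toReal
      ≤ ‖ξ‖ ^ (2 : ENNReal).toReal := by
  classical
  have h0 : (0 : ℝ) < (2 : ENNReal).toReal := by norm_num
  calc ∑ σ ∈ s, ‖if S.restrict σ = i then ξ (patch S j σ) else 0‖ ^ (2 : ENNReal).toReal
      = ∑ σ ∈ s with S.restrict σ = i, ‖ξ (patch S j σ)‖ ^ (2 : ENNReal).toReal := by
        rw [Finset.sum_filter]
        refine Finset.sum_congr rfl fun σ _ => ?_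
        split_ifs
        · rfl
        · rw [norm_zero, Real.zero_rpow h0.ne']
    _ = ∑ τ ∈ (s.filter (fun σ => S.restrict σ = i)).image (patch S j),
          ‖ξ τ‖ ^ (2 : ENNReal).toReal := by
        rw [Finset.sum_image]
        exact (patch_injOn S i j).mono fun σ hσ => by simpa using (Finset.mem_filter.1 hσ).2
    _ ≤ ‖ξ‖ ^ (2 : ENNReal).toReal :=
        lp.sum_rpow_le_norm_rpow (E := fun _ : Conf d k => ℂ) h0 ξ _

/-- The matrix unit `e_{ij}` of `⨂_{x ∈ S} M_d` as an operator: it sends the basis vector of a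
configuration `σ` with `σ|_S = j` to that of `σ` changed to `i` on `S`, and the other basis vectors
to `0`. -/
def unit (S : Finset (Vertex k)) (i j : S → Fin d) : Op d k :=
  LinearMap.mkContinuous
    { toFun := fun ξ =>
        ⟨fun σ => if S.restrict σ = i then ξ (patch S j σ) else 0,
          memℓp_gen' (C := ‖ξ‖ ^ (2 : ENNReal).toReal) (sum_unit_le S i j ξ)⟩
      map_add' := fun ξ η => by
        refine Hil.ext fun σ => ?_
        change (if _ then _ else _ : ℂ) = (if _ then _ else _) + (if _ then _ else _)
        by_cases h : S.restrict σ = i <;> simp [h]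
      map_smul' := fun c ξ => by
        refine Hil.ext fun σ => ?_
        change (if _ then _ else _ : ℂ) = c * (if _ then _ else _)
        by_cases h : S.restrict σ = i <;> simp [h] }
    1 (fun ξ => by
      rw [one_mul]
      exact lp.norm_le_of_forall_sum_le (E := fun _ : Conf d k => ℂ) (by norm_num)
        (norm_nonneg ξ) (sum_unit_le S i j ξ))

theorem unit_apply (S : Finset (Vertex k)) (i j : S → Fin d) (ξ : Hil d k) (σ : Conf d k) :
    unit S i j ξ σ = if S.restrict σ = i then ξ (patch S j σ) else 0 := rfl

theorem unit_mul_unit (S : Finset (Vertex k)) (i j l m : S → Fin d) :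
    unit S i j * unit S l m = if j = l then unit S i m else 0 := by
  ext ξ σ
  by_cases hi : S.restrict σ = i <;> by_cases hj : j = l <;>
    simp [unit_apply, hi, hj]

theorem star_unit (S : Finset (Vertex k)) (i j : S → Fin d) :
    star (unit S i j) = unit S j i := by
  rw [ContinuousLinearMap.star_eq_adjoint]
  symm
  rw [ContinuousLinearMap.eq_adjoint_iff]
  intro ξ η
  rw [Hil.inner_eq, Hil.inner_eq]
  refine tsum_eq_tsum_of_ne_zero_bij (fun τ => patch S j τ.1) ?_ ?_ ?_
  · intro σ τ h
    have key : ∀ σ : Function.support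
        (fun σ => inner ℂ (ξ σ) (unit S i j η σ)), S.restrict σ.1 = i := by
      intro σ
      by_contra hσ
      exact σ.2 (by simp [unit_apply, hσ])
    exact Subtype.ext (patch_injOn S i j (key σ) (key τ) h)
  · intro σ hσ
    have hj : S.restrict σ = j := by
      by_contra h
      exact hσ (by simp [unit_apply, h])
    have hσ' : patch S j (patch S i σ) = σ := by
      rw [patch_patch, ← hj, patch_restrict]
    refine ⟨⟨patch S i σ, ?_⟩, hσ'⟩
    simpa [unit_apply, hσ', hj] using hσ
  · rintro ⟨σ, hσ⟩
    have hi : S.restrict σ = i := by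
      by_contra h
      exact hσ (by simp [unit_apply, h])
    have : patch S i σ = σ := by rw [← hi, patch_restrict]
    simp [unit_apply, hi, this]

theorem sum_unit (S : Finset (Vertex k)) :
    ∑ i : S → Fin d, (unit S i i : Op d k) = 1 := by
  ext ξ σ
  rw [_root_.sum_apply, Hil.sum_apply,
    Finset.sum_eq_single (S.restrict σ)]
  · simp [unit_apply]
  · intro i _ hi
    simp [unit_apply, hi.symm]
  · simp

/-- The action of a matrix on the Hilbert space, as a combination of matrix units. -/
def repFun (S : Finset (Vertex k)) (a : Mat d S) : Op d k :=
  ∑ i, ∑ j, a i j • unit S i j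

theorem repFun_apply (S : Finset (Vertex k)) (a : Mat d S) (ξ : Hil d k) (σ : Conf d k) :
    repFun S a ξ σ = ∑ j, a (S.restrict σ) j * ξ (patch S j σ) := by
  rw [repFun, _root_.sum_apply, Hil.sum_apply,
    Finset.sum_eq_single (S.restrict σ)]
  · rw [_root_.sum_apply, Hil.sum_apply]
    simp [unit_apply]
  · intro i _ hi
    rw [_root_.sum_apply, Hil.sum_apply]
    simp [unit_apply, hi.symm]
  · simp

/-- The representation of `⨂_{x ∈ S} M_d` on the Hilbert space. -/
def rep (S : Finset (Vertex k)) : Mat d S →⋆ₐ[ℂ] Op d k :=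
  { toFun := repFun S
    map_one' := by
      ext ξ σ
      simp [repFun_apply, Matrix.one_apply]
    map_mul' := fun a b => by
      ext ξ σ
      simp only [repFun_apply, mul_apply_eq_comp, Matrix.mul_apply, restrict_patch,
        patch_patch, Finset.sum_mul, Finset.mul_sum, mul_assoc]
      exact Finset.sum_comm
    map_zero' := by simp [repFun]
    map_add' := fun a b => by simp [repFun, add_smul, Finset.sum_add_distrib]
    commutes' := fun c => by
      ext ξ σ
      rw [repFun_apply, Finset.sum_eq_single (S.restrict σ)] <;>
        simp +contextual [Matrix.algebraMap_matrix_apply, Algebra.algebraMap_eq_smul_one, eq_comm]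
    map_star' := fun a => by
      simp only [repFun, star_sum, star_smul, star_unit, Matrix.star_apply]
      rw [Finset.sum_comm] }

/-- The matrix elements of `rep S a` are those of `a` between configurations that agree off `S`. -/
theorem rep_apply (S : Finset (Vertex k)) (a : Mat d S) (ξ : Hil d k) (σ : Conf d k) :
    rep S a ξ σ = ∑ j, a (S.restrict σ) j * ξ (patch S j σ) :=
  repFun_apply S a ξ σ

/-- The observables localized in a (finite or infinite) set `X` of vertices: the norm closure of the
⋆-algebra generated by the `⨂_{x ∈ S} M_d` with `S ⊆ X` finite. -/
def alg (d : ℕ) {k : ℕ} (X : Set (Vertex k)) : StarSubalgebra ℂ (Op d k) :=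
  (StarAlgebra.adjoin ℂ
    {A : Op d k | ∃ S : Finset (Vertex k), (S : Set (Vertex k)) ⊆ X ∧
      ∃ a : Mat d S, rep S a = A}).topologicalClosure

instance isClosed_alg (X : Set (Vertex k)) : IsClosed (alg d X : Set (Op d k)) :=
  StarSubalgebra.isClosed_topologicalClosure _

instance partialOrder_alg (X : Set (Vertex k)) : PartialOrder (alg d X) :=
  CStarAlgebra.spectralOrder (alg d X)

instance starOrderedRing_alg (X : Set (Vertex k)) : StarOrderedRing (alg d X) :=
  CStarAlgebra.spectralOrderedRing (alg d X)

theorem alg_mono {X Y : Set (Vertex k)} (h : X ⊆ Y) : alg d X ≤ alg d Y :=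
  StarSubalgebra.topologicalClosure_mono
    (StarAlgebra.adjoin_mono fun _ ⟨S, hS, a⟩ => ⟨S, hS.trans h, a⟩)

/-- The norm closure of the union of all local algebras. -/
abbrev QuasiLocal (d k : ℕ) : Type := alg d (Set.univ : Set (Vertex k))

/-- `W_n ∪ W_{n+1} ∪ ⋯`, the vertices of level at least `n`. -/
def tail (k n : ℕ) : Set (Vertex k) := {x | n ≤ x.length}

/-! ### Normalized traces -/

/-- The normalized partial trace over the finitely many sites of `S`,
`A ↦ d^{-|S|} ∑_{i,j} e_{ij} A e_{ji}`: on `B_S ⊗ B_{S^c}` it is `a ⊗ b ↦ tr(a) (1 ⊗ b)`. -/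
def trOut (S : Finset (Vertex k)) (A : Op d k) : Op d k :=
  ((d : ℂ) ^ S.card)⁻¹ • ∑ i : S → Fin d, ∑ j : S → Fin d, unit S i j * A * unit S j i

theorem repFun_single (S : Finset (Vertex k)) (i j : S → Fin d) :
    (rep S (Matrix.single i j 1) : Op d k) = unit S i j := by
  ext ξ σ
  by_cases h : S.restrict σ = i <;>
    simp [rep_apply, unit_apply, Matrix.single_apply, h, Ne.symm]

theorem trOut_rep (S : Finset (Vertex k)) (a : Mat d S) :
    trOut S (rep S a : Op d k) = (a.trace / (d : ℂ) ^ S.card) • (1 : Op d k) := by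
  have h : ∀ i j : S → Fin d,
      (unit S i j * rep S a * unit S j i : Op d k) = a j j • unit S i i := by
    intro i j
    ext ξ σ
    by_cases hi : S.restrict σ = i <;>
      simp [unit_apply, rep_apply, hi]
  simp only [trOut, h]
  rw [Finset.sum_comm]
  simp only [← Finset.smul_sum, sum_unit]
  rw [← Finset.sum_smul, smul_smul, Matrix.trace, div_eq_inv_mul]
  rfl

theorem ket_apply_self (σ : Conf d k) : ket σ σ = 1 := by
  classical
  simp only [ket, Hil.coord]
  exact lp.single_apply_self (E := fun _ : Conf d k => ℂ) 2 σ 1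

theorem ket_apply_ne {σ τ : Conf d k} (h : τ ≠ σ) : ket σ τ = 0 := by
  classical
  simp only [ket, Hil.coord]
  exact lp.single_apply_ne (E := fun _ : Conf d k => ℂ) 2 σ 1 h

/-- The normalized trace on `B_S`: the average of the diagonal matrix elements over the
configurations in `S` (the configuration off `S` is irrelevant for observables in `B_S`, and is
taken to be `0`). -/
def ntr [NeZero d] (S : Finset (Vertex k)) : Op d k →ₗ[ℂ] ℂ where
  toFun A := ((d : ℂ) ^ S.card)⁻¹ * ∑ i : S → Fin d, A (ket (patch S i 0)) (patch S i 0)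
  map_add' A B := by simp [Finset.sum_add_distrib, mul_add]
  map_smul' c A := by simp [← Finset.mul_sum, mul_left_comm]

theorem ntr_rep [NeZero d] (S : Finset (Vertex k)) (a : Mat d S) :
    ntr S (rep S a : Op d k) = a.trace / (d : ℂ) ^ S.card := by
  rw [div_eq_inv_mul]
  change ((d : ℂ) ^ S.card)⁻¹ *
    ∑ i : S → Fin d, (rep S a : Op d k) (ket (patch S i 0)) (patch S i 0) = _
  congr 1
  refine Finset.sum_congr rfl fun i _ => ?_
  rw [rep_apply, restrict_patch, Finset.sum_eq_single i]
  · simp [ket_apply_self, Matrix.diag]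
  · intro j _ hj
    rw [ket_apply_ne, mul_zero]
    intro h
    apply hj
    have := congrArg S.restrict h
    simpa using this
  · simp

/-! ### The finite-volume functionals -/

/-- Edge operators `K_{⟨x,y⟩} ∈ B_{x,y}`, with `y = (x, i)`. -/
abbrev EdgeOps (d k : ℕ) : Type := ∀ (x : Vertex k) (i : Fin k), Mat d {x, child x i}

/-- A family `h_x ∈ B_x`. -/
abbrev SiteOps (d k : ℕ) : Type := ∀ x : Vertex k, Mat d {x}

/-- `K_{⟨x,y⟩}`, `y = (x, i)`, as an observable of the tree. -/
def edge (K : EdgeOps d k) (x : Vertex k) (i : Fin k) : Op d k := rep {x, child x i} (K x i)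

/-- `h_x` as an observable of the tree. -/
def site (h : SiteOps d k) (x : Vertex k) : Op d k := rep {x} (h x)

/-- The ordered product of the `K_{⟨x,y⟩}` over the direct successors `y` of `x`. -/
def succProd (K : EdgeOps d k) (x : Vertex k) : Op d k :=
  ((List.finRange k).map fun i => edge K x i).prod

/-- The product of the `K_{⟨x,y⟩}⋆` over the direct successors `y` of `x`, in reverse order. -/
def succProdStar (K : EdgeOps d k) (x : Vertex k) : Op d k :=
  ((List.finRange k).reverse.map fun i => star (edge K x i)).prod

/-- `K_{[n,n+1]}`. -/
def layer (K : EdgeOps d k) (n : ℕ) : Op d k := ((level k n).map fun x => succProd K x).prod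

/-- `𝐡_n^{1/2}`. -/
def sqrtBdry (h : SiteOps d k) (n : ℕ) : Op d k :=
  ((level k n).map fun x => CFC.sqrt (site h x)).prod

/-- `w_0` as an observable of the tree. -/
def root (w : Mat d ({[]} : Finset (Vertex k))) : Op d k := rep {[]} w

/-- `K_n = w_0^{1/2} K_{[0,1]} ⋯ K_{[n-1,n]} 𝐡_n^{1/2}`. -/
def ampl (K : EdgeOps d k) (w : Mat d ({[]} : Finset (Vertex k))) (h : SiteOps d k) (n : ℕ) :
    Op d k :=
  CFC.sqrt (root w) * ((List.range n).map fun m => layer K m).prod * sqrtBdry h n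

/-- `𝒲_{n]} = K_n K_n⋆`. -/
def density (K : EdgeOps d k) (w : Mat d ({[]} : Finset (Vertex k))) (h : SiteOps d k) (n : ℕ) :
    Op d k :=
  ampl K w h n * star (ampl K w h n)

/-- `φ^{(n,f)}(a) = tr(𝒲_{n+1]} (a ⊗ 1))` for `a ∈ B_{Λ_n}`. -/
def finVol [NeZero d] (K : EdgeOps d k) (w : Mat d ({[]} : Finset (Vertex k)))
    (h : SiteOps d k) (n : ℕ) : alg d (ball k n : Set (Vertex k)) →ₗ[ℂ] ℂ :=
  ntr (ball k (n + 1)) ∘ₗ LinearMap.mulLeft ℂ (density K w h (n + 1)) ∘ₗ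
    (alg d (ball k n : Set (Vertex k))).toSubalgebra.val.toLinearMap

theorem finVol_apply [NeZero d] (K : EdgeOps d k) (w : Mat d ({[]} : Finset (Vertex k)))
    (h : SiteOps d k) (n : ℕ) (A : alg d (ball k n : Set (Vertex k))) :
    finVol K w h n A = ntr (ball k (n + 1)) (density K w h (n + 1) * (A : Op d k)) := rfl

theorem ball_mono {m n : ℕ} (h : m ≤ n) :
    (ball k m : Set (Vertex k)) ⊆ (ball k n : Set (Vertex k)) :=
  fun _ hx => mem_ball.2 ((mem_ball.1 hx).trans h)

/-- The embedding `B_X ⊆ B_Y` for `X ⊆ Y`. -/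
def incl {X Y : Set (Vertex k)} (h : X ⊆ Y) : alg d X →⋆ₐ[ℂ] alg d Y :=
  StarSubalgebra.inclusion (alg_mono h)

/-! ### States, quasi-conditional expectations, forward quantum Markov chains -/

/-- States of a unital C⋆-algebra. -/
structure IsState {A : Type*} [CStarAlgebra A] (φ : A →ₗ[ℂ] ℂ) : Prop where
  map_one : φ 1 = 1
  nonneg : ∀ a, 0 ≤ φ (star a * a)

/-- Weak-⋆ convergence of functionals `f n` on the growing algebras `B_{Λ_n}` to a functional `φ` on
the quasi-local algebra: the values on every local observable converge and, moreover, any states of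
the quasi-local algebra that extend the `f n` converge to `φ` in the weak-⋆ topology. -/
def IsWeakStarLimit (f : ∀ n : ℕ, alg d (ball k n : Set (Vertex k)) →ₗ[ℂ] ℂ)
    (φ : QuasiLocal d k →ₗ[ℂ] ℂ) : Prop :=
  (∀ (m : ℕ) (A : alg d (ball k m : Set (Vertex k))),
    Filter.Tendsto (fun n => f (m + n) (incl (ball_mono (Nat.le_add_right m n)) A)) Filter.atTop
      (nhds (φ (incl (Set.subset_univ _) A)))) ∧
  ∀ ψ : ℕ → QuasiLocal d k →ₗ[ℂ] ℂ, (∀ n, IsState (ψ n)) →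
    (∀ n A, ψ n (incl (Set.subset_univ _) A) = f n A) →
    ∀ A, Filter.Tendsto (fun n => ψ n A) Filter.atTop (nhds (φ A))

/-- A completely positive map `E : B_X → B_Y` is a quasi-conditional expectation with respect to the
triplet `B_Z ⊆ B_Y ⊆ B_X`. -/
structure IsQuasiCondExp (Z : Set (Vertex k)) {Y X : Set (Vertex k)} (E : alg d X →CP alg d Y) :
    Prop where
  subset_left : Z ⊆ Y
  subset_right : Y ⊆ X
  map_one : E 1 = 1
  map_mul : ∀ c a : alg d X, (c : Op d k) ∈ alg d Z →
    ((E (c * a) : alg d Y) : Op d k) = (c : Op d k) * ((E a : alg d Y) : Op d k)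

/-- The composition of the first `n` maps of a sequence. -/
def compose (E : ∀ n : ℕ, alg d (tail k n) →CP alg d (tail k (n + 1))) :
    ∀ n : ℕ, QuasiLocal d k →ₗ[ℂ] alg d (tail k n)
  | 0 => (incl fun x _ => Nat.zero_le x.length : alg d Set.univ →⋆ₐ[ℂ] alg d (tail k 0)).toLinearMap
  | n + 1 => (E n).toLinearMap ∘ₗ compose E n

/-- `φ` is the forward quantum Markov chain with quasi-conditional expectations
`E n = ℰ_{Λ_{n+1}^c}` and states `φhat n = φ̂_{Λ_n^c}`, where `Λ_n^c = W_n ∪ W_{n+1} ∪ ⋯`. -/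
structure IsForwardQMCWith (φ : QuasiLocal d k →ₗ[ℂ] ℂ)
    (E : ∀ n : ℕ, alg d (tail k n) →CP alg d (tail k (n + 1)))
    (φhat : ∀ n : ℕ, alg d (tail k n) →ₗ[ℂ] ℂ) : Prop where
  isState : IsState φ
  isQuasiCondExp : ∀ n, IsQuasiCondExp (tail k (n + 2)) (E n)
  isState_hat : ∀ n, IsState (φhat n)
  /-- Agreement on `B_{W_n ∪ W_{n+1}}`, hence on `B_{W_n}` and on `B_{W_{n+1}} = B_{Λ_{n+1} ∖ Λ_n}`. -/
  markov : ∀ (n : ℕ) (a : alg d (tail k n)),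
    (a : Op d k) ∈ alg d {x : Vertex k | x.length = n ∨ x.length = n + 1} →
      φhat n a = φhat (n + 1) (E n a)
  tendsto : ∀ a : QuasiLocal d k,
    Filter.Tendsto (fun n => φhat n (compose E n a)) Filter.atTop (nhds (φ a))

/-! ### The explicit transition maps -/

/-- `a ↦ tr_{Λ_{n+1}^c}(K_{[n,n+1]}⋆ a K_{[n,n+1]})` for `a ∈ B_{Λ_n^c}`; the partial trace is over
the sites of `W_n`. -/
def transition (K : EdgeOps d k) (n : ℕ) (A : Op d k) : Op d k :=
  trOut (sphere k n) (star (layer K n) * A * layer K n)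

/-- `ρ_0 = w_0` and `ρ_{n+1}` is the image of `ρ_n` under the transition map; `ρ_n ∈ B_{W_n}`. -/
def weight (K : EdgeOps d k) (w : Mat d ({[]} : Finset (Vertex k))) : ℕ → Op d k
  | 0 => root w
  | n + 1 => transition K n (weight K w n)

end QMC

end

open scoped CStarAlgebra ComplexOrder

noncomputable section

namespace QMC

variable {d k : ℕ}

/-! ### Matrix units and local algebras -/

/-! Let H_n be the product of the h_x over W_n. The condition on h says that the last layer can be
integrated out: against an observable of Λ_n, the density K_{[n,n+1]} H_{n+1} K_{[n,n+1]}⋆ has the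
same trace as H_n (`ntr_layer`). Distinct vertices of a level, taken with their successors, occupy
disjoint sets of sites, so the level can be treated one vertex at a time. With cyclicity of the
trace this gives compatibility.

Under the trace, T_n is dual to Z ↦ K_{[n-1,n]} Z K_{[n-1,n]}⋆ (`ntr_transition`), so ρ_n stores the
layers already absorbed. The expectation ℰ_n normalizes T_n: it is ρ_n^{-1/2} T_n(ρ_{n-1}^{1/2} a
ρ_{n-1}^{1/2}) ρ_n^{-1/2} + P tr(a) P, where the inverse is a generalized one, P projects onto the
kernel of ρ_n, tr is the partial trace over W_{n-1}, and the second term restores ℰ_n(1) = 1 when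
ρ_n is singular. Compressing by ρ_n^{1/2} loses nothing, because the Kraus operators of the first
term vanish on the kernel of ρ_n (`transitionKraus_mul_kerProj`, `sqrtWeight_conj_condExp`). All
Kraus operators of ℰ_n live on W_{n-1} ∪ W_n, so ℰ_n is linear over the observables further out.

The states `hatState` have density ρ_n^{1/2} K_{[n,n+1]} H_{n+1} K_{[n,n+1]}⋆ ρ_n^{1/2} on W_n ∪
W_{n+1}. Duality and harmonicity give the Markov property (`hatState_condExp`); iterated, they show
that φ̂_n ∘ ℰ_n ∘ ⋯ ∘ ℰ_1 is a state on the whole algebra extending φ^{(n,f)} (`hatState_compose`).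
Hence φ^{(n,f)} is a state. Since states are contractive and local observables are dense, all
extensions of the compatible family share one limit (`exists_isWeakStarLimit`). -/

theorem rep_eq_sum (S : Finset (Vertex k)) (a : Mat d S) :
    (rep S a : Op d k) = ∑ i, ∑ j, a i j • unit S i j := rfl

theorem unit_mem_range_rep (S : Finset (Vertex k)) (i j : S → Fin d) :
    (unit S i j : Op d k) ∈ (rep S).range :=
  ⟨Matrix.single i j 1, repFun_single S i j⟩

/-- Indexing by global configurations restricted to S, T and S ∪ T avoids gluing functions on
subtypes. This factorization is the tensor product structure used below. -/
theorem unit_union {S T : Finset (Vertex k)} (h : Disjoint S T) (α β : Conf d k) :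
    (unit (S ∪ T) ((S ∪ T).restrict α) ((S ∪ T).restrict β) : Op d k) =
      unit S (S.restrict α) (S.restrict β) * unit T (T.restrict α) (T.restrict β) := by
  ext ξ σ
  have hT : T.restrict (patch S (S.restrict β) σ) = T.restrict σ := by
    funext x
    simp [patch, Finset.disjoint_right.1 h x.2]
  have hp : patch T (T.restrict β) (patch S (S.restrict β) σ) =
      patch (S ∪ T) ((S ∪ T).restrict β) σ := by
    funext x
    by_cases hS : x ∈ S <;> by_cases hT : x ∈ T <;> simp [patch, hS, hT]
  have hr : (S ∪ T).restrict σ = (S ∪ T).restrict α ↔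
      S.restrict σ = S.restrict α ∧ T.restrict σ = T.restrict α := by
    simp only [funext_iff, Finset.restrict, Subtype.forall, Finset.mem_union]
    constructor
    · exact fun H => ⟨fun x hx => H x (Or.inl hx), fun x hx => H x (Or.inr hx)⟩
    · rintro ⟨H1, H2⟩ x (hx | hx)
      exacts [H1 x hx, H2 x hx]
  rw [mul_apply_eq_comp, unit_apply, unit_apply, unit_apply, hT, hp]
  by_cases h1 : S.restrict σ = S.restrict α <;> by_cases h2 : T.restrict σ = T.restrict α <;>
    simp [hr, h1, h2]

theorem exists_restrict_eq [NeZero d] {S : Finset (Vertex k)} (i : S → Fin d) :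
    ∃ α : Conf d k, S.restrict α = i :=
  ⟨patch S i 0, restrict_patch S i 0⟩

theorem exists_restrict_eq_and {S T : Finset (Vertex k)} [NeZero d] (h : Disjoint S T)
    (i : S → Fin d) (l : T → Fin d) :
    ∃ α : Conf d k, S.restrict α = i ∧ T.restrict α = l := by
  refine ⟨patch S i (patch T l 0), restrict_patch _ _ _, ?_⟩
  funext x
  simp [patch, Finset.disjoint_right.1 h x.2]

theorem unit_mul_unit_of_disjoint [NeZero d] {S T : Finset (Vertex k)} (h : Disjoint S T)
    (i j : S → Fin d) (l m : T → Fin d) :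
    (unit S i j * unit T l m : Op d k) ∈ (rep (S ∪ T)).range := by
  obtain ⟨α, rfl, rfl⟩ := exists_restrict_eq_and (k := k) h i l
  obtain ⟨β, rfl, rfl⟩ := exists_restrict_eq_and (k := k) h j m
  rw [← unit_union h]
  exact unit_mem_range_rep _ _ _

theorem unit_commute [NeZero d] {S T : Finset (Vertex k)} (h : Disjoint S T)
    (i j : S → Fin d) (l m : T → Fin d) :
    Commute (unit S i j : Op d k) (unit T l m) := by
  obtain ⟨α, rfl, rfl⟩ := exists_restrict_eq_and (k := k) h i l
  obtain ⟨β, rfl, rfl⟩ := exists_restrict_eq_and (k := k) h j m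
  rw [Commute, SemiconjBy, ← unit_union h, ← unit_union h.symm]
  -- The index types of the units depend on the set, so S ∪ T = T ∪ S is transported by
  -- substitution.
  have : ∀ U : Finset (Vertex k), S ∪ T = U →
      (unit (S ∪ T) ((S ∪ T).restrict α) ((S ∪ T).restrict β) : Op d k) =
        unit U (U.restrict α) (U.restrict β) := by
    rintro _ rfl; rfl
  exact this _ (Finset.union_comm S T)

theorem rep_mem_of_unit_mem {S : Finset (Vertex k)} {M : StarSubalgebra ℂ (Op d k)}
    (h : ∀ i j, unit S i j ∈ M) (a : Mat d S) : rep S a ∈ M := by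
  rw [rep_eq_sum]
  exact sum_mem fun i _ => sum_mem fun j _ => M.smul_mem (h i j) _

/-- Tensoring with 1 on the extra sites: 1 is the sum of the diagonal matrix units of T \ S. -/
theorem range_rep_mono [NeZero d] {S T : Finset (Vertex k)} (h : S ⊆ T) :
    (rep S).range ≤ ((rep T).range : StarSubalgebra ℂ (Op d k)) := by
  rintro _ ⟨a, rfl⟩
  refine rep_mem_of_unit_mem (fun i j => ?_) a
  rw [← mul_one (unit S i j), ← sum_unit (T \ S), Finset.mul_sum]
  refine sum_mem fun m _ => ?_
  have := unit_mul_unit_of_disjoint (k := k) Finset.disjoint_sdiff i j m m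
  rwa [Finset.union_sdiff_of_subset h] at this

/-- The local observables with support in `X`. -/
def localAlg (d : ℕ) [NeZero d] {k : ℕ} (X : Set (Vertex k)) : StarSubalgebra ℂ (Op d k) where
  carrier := {A | ∃ S : Finset (Vertex k), (S : Set (Vertex k)) ⊆ X ∧ A ∈ (rep (d := d) S).range}
  mul_mem' := by
    rintro A B ⟨S, hS, hA⟩ ⟨T, hT, hB⟩
    exact ⟨S ∪ T, by simp [hS, hT], mul_mem (range_rep_mono Finset.subset_union_left hA)
      (range_rep_mono Finset.subset_union_right hB)⟩
  add_mem' := by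
    rintro A B ⟨S, hS, hA⟩ ⟨T, hT, hB⟩
    exact ⟨S ∪ T, by simp [hS, hT], add_mem (range_rep_mono Finset.subset_union_left hA)
      (range_rep_mono Finset.subset_union_right hB)⟩
  algebraMap_mem' c := ⟨∅, by simp, algebraMap_mem _ c⟩
  star_mem' := by
    rintro A ⟨S, hS, hA⟩
    exact ⟨S, hS, star_mem hA⟩

theorem rep_mem_alg {X : Set (Vertex k)} {S : Finset (Vertex k)} (h : (S : Set (Vertex k)) ⊆ X)
    (a : Mat d S) : rep S a ∈ alg d X :=
  StarSubalgebra.le_topologicalClosure _ (StarAlgebra.subset_adjoin ℂ _ ⟨S, h, a, rfl⟩)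

theorem unit_mem_alg {X : Set (Vertex k)} {S : Finset (Vertex k)} (h : (S : Set (Vertex k)) ⊆ X)
    (i j : S → Fin d) : unit S i j ∈ alg d X := by
  rw [← repFun_single]
  exact rep_mem_alg h _

theorem continuous_trOut (S : Finset (Vertex k)) : Continuous (trOut S : Op d k → Op d k) := by
  unfold trOut
  fun_prop

theorem trOut_sum {ι : Type*} (s : Finset ι) (S : Finset (Vertex k)) (f : ι → Op d k) :
    trOut S (∑ i ∈ s, f i) = ∑ i ∈ s, trOut S (f i) := by
  simp only [trOut, Finset.mul_sum, Finset.sum_mul, Finset.smul_sum]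
  rw [Finset.sum_comm]
  simp_rw [Finset.sum_comm (s := s)]
  rw [Finset.sum_comm]

theorem trOut_smul (S : Finset (Vertex k)) (c : ℂ) (A : Op d k) :
    trOut S (c • A) = c • trOut S A := by
  simp only [trOut, mul_smul_comm, smul_mul_assoc, ← Finset.smul_sum]
  rw [smul_comm]

theorem ket_inner (σ : Conf d k) (ξ : Hil d k) : inner ℂ (ket σ) ξ = ξ σ := by
  rw [Hil.inner_eq, tsum_eq_single σ]
  · simp [ket_apply_self]
  · intro τ hτ
    simp [ket_apply_ne hτ]

section

variable [NeZero d]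

/-- The local algebras are directed under inclusion, so their union is already a ⋆-algebra and
closed properties need checking only on the `rep S a`. -/
theorem alg_eq_topologicalClosure_localAlg (X : Set (Vertex k)) :
    alg d X = (localAlg d X).topologicalClosure := by
  refine le_antisymm (StarSubalgebra.topologicalClosure_mono ?_)
    (StarSubalgebra.topologicalClosure_minimal ?_ (isClosed_alg X))
  · rw [StarAlgebra.adjoin_le_iff]
    rintro _ ⟨S, hS, a, rfl⟩
    exact ⟨S, hS, a, rfl⟩
  · rintro _ ⟨S, hS, a, rfl⟩
    exact rep_mem_alg hS a

/-- A closed property of observables holds on `alg d X` if it holds for all local ones. -/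
theorem alg_induction {X : Set (Vertex k)} {p : Op d k → Prop} (hp : IsClosed {A | p A})
    (h : ∀ S : Finset (Vertex k), (S : Set (Vertex k)) ⊆ X → ∀ a : Mat d S, p (rep S a))
    {A : Op d k} (hA : A ∈ alg d X) : p A := by
  rw [alg_eq_topologicalClosure_localAlg] at hA
  refine closure_minimal (s := (localAlg d X : Set (Op d k))) ?_ hp hA
  rintro _ ⟨S, hS, a, rfl⟩
  exact h S hS a

/-- Over finitely many sites the range of `rep` is finite-dimensional, hence closed, and the closure
adds nothing. -/
theorem mem_alg_finset {S : Finset (Vertex k)} {A : Op d k} :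
    A ∈ alg d (S : Set (Vertex k)) ↔ ∃ a : Mat d S, rep S a = A := by
  refine ⟨fun hA => ?_, fun ⟨a, ha⟩ => ha ▸ rep_mem_alg subset_rfl a⟩
  refine alg_induction (p := fun A => ∃ a : Mat d S, rep S a = A) ?_ ?_ hA
  · have := (LinearMap.range
      (rep S : Mat d S →⋆ₐ[ℂ] Op d k).toLinearMap).closed_of_finiteDimensional
    exact this
  · intro T hT a
    exact range_rep_mono (by exact_mod_cast hT) ⟨a, rfl⟩

theorem commute_of_disjoint {X Y : Set (Vertex k)} (h : Disjoint X Y) {A B : Op d k}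
    (hA : A ∈ alg d X) (hB : B ∈ alg d Y) : Commute A B := by
  have hcl : ∀ B : Op d k, IsClosed {A : Op d k | Commute A B} := fun B =>
    isClosed_eq (by fun_prop) (by fun_prop)
  refine alg_induction (p := fun A => Commute A B) (hcl B) (fun S hS a => ?_) hA
  refine alg_induction (p := fun B => Commute (rep S a) B) ?_ (fun T hT b => ?_) hB
  · simpa only [commute_iff_eq, eq_comm] using hcl (rep S a)
  · have hd : Disjoint S T := by
      rw [← Finset.disjoint_coe]
      exact h.mono hS hT
    rw [rep_eq_sum, rep_eq_sum]
    refine Commute.sum_left _ _ _ fun i _ => Commute.sum_left _ _ _ fun j _ =>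
      Commute.smul_left (Commute.sum_right _ _ _ fun l _ => Commute.sum_right _ _ _ fun m _ =>
        Commute.smul_right (unit_commute hd i j l m) _) _

/-! ### The partial trace -/

theorem trOut_mul_left {X : Set (Vertex k)} {S : Finset (Vertex k)}
    (h : Disjoint X (S : Set (Vertex k))) {C : Op d k} (hC : C ∈ alg d X) (A : Op d k) :
    trOut S (C * A) = C * trOut S A := by
  simp only [trOut, mul_smul_comm, Finset.mul_sum, ← mul_assoc,
    (commute_of_disjoint h hC (unit_mem_alg subset_rfl _ _)).eq]

theorem trOut_mul_right {X : Set (Vertex k)} {S : Finset (Vertex k)}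
    (h : Disjoint X (S : Set (Vertex k))) {C : Op d k} (hC : C ∈ alg d X) (A : Op d k) :
    trOut S (A * C) = trOut S A * C := by
  simp only [trOut, smul_mul_assoc, Finset.sum_mul, mul_assoc,
    (commute_of_disjoint h hC (unit_mem_alg subset_rfl _ _)).eq]

theorem trOut_one (S : Finset (Vertex k)) : trOut S (1 : Op d k) = 1 := by
  rw [← map_one (rep S), trOut_rep, Matrix.trace_one]
  have : (d : ℂ) ≠ 0 := NeZero.ne _
  simp [this]

theorem trOut_mem_alg {X : Set (Vertex k)} {S : Finset (Vertex k)} {A : Op d k}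
    (hA : A ∈ alg d X) : trOut S A ∈ alg d (X \ S) := by
  refine alg_induction (p := fun A => trOut S A ∈ alg d (X \ S))
    ((isClosed_alg (d := d) (X \ S)).preimage (continuous_trOut S)) (fun T hT a => ?_) hA
  rw [rep_eq_sum, trOut_sum]
  refine sum_mem fun i _ => ?_
  rw [trOut_sum]
  refine sum_mem fun j _ => ?_
  rw [trOut_smul]
  refine StarSubalgebra.smul_mem _ ?_ _
  -- A unit factors into its parts inside and outside S: the outer part commutes with the partial
  -- trace, and the inner part is traced to a scalar.
  have key : ∀ S' T' : Finset (Vertex k), S' ⊆ S → Disjoint T' S → (T' : Set (Vertex k)) ⊆ X →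
      T = S' ∪ T' → trOut S (unit T i j : Op d k) ∈ alg d (X \ S) := by
    rintro S' T' hS' hT' hX rfl
    obtain ⟨α, rfl⟩ := exists_restrict_eq i
    obtain ⟨β, rfl⟩ := exists_restrict_eq j
    have hT'' : Disjoint (T' : Set (Vertex k)) S := by exact_mod_cast hT'
    rw [unit_union (hT'.symm.mono_left hS'),
      trOut_mul_right hT'' (unit_mem_alg subset_rfl _ _)]
    obtain ⟨b, hb⟩ := range_rep_mono hS' (unit_mem_range_rep S' (S'.restrict α) (S'.restrict β))
    rw [← hb]
    refine mul_mem ?_ (unit_mem_alg (Set.subset_sdiff.2 ⟨hX, hT''⟩) _ _)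
    refine (trOut_rep S b).symm ▸ StarSubalgebra.smul_mem _ (one_mem _) _
  refine key (T ∩ S) (T \ S) Finset.inter_subset_right Finset.sdiff_disjoint
    ((Finset.coe_subset.2 Finset.sdiff_subset).trans hT) ?_
  rw [Finset.union_comm, Finset.sdiff_union_inter]

/-! ### The normalized trace -/

theorem ntr_mul_comm {S : Finset (Vertex k)} {A B : Op d k} (hA : A ∈ alg d (S : Set (Vertex k)))
    (hB : B ∈ alg d (S : Set (Vertex k))) : ntr S (A * B) = ntr S (B * A) := by
  obtain ⟨a, rfl⟩ := mem_alg_finset.1 hA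
  obtain ⟨b, rfl⟩ := mem_alg_finset.1 hB
  rw [← map_mul, ← map_mul, ntr_rep, ntr_rep, Matrix.trace_mul_comm]

theorem trOut_eq_ntr {S : Finset (Vertex k)} {A : Op d k} (hA : A ∈ alg d (S : Set (Vertex k))) :
    trOut S A = ntr S A • (1 : Op d k) := by
  obtain ⟨a, rfl⟩ := mem_alg_finset.1 hA
  rw [trOut_rep, ntr_rep]

/-- By cyclicity tr(e_ij A e_ji) = tr(e_jj A), which does not depend on i; the sum over i yields the
factor d^|T| that the normalization removes. -/
theorem ntr_trOut {S T : Finset (Vertex k)} (h : T ⊆ S) {A : Op d k}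
    (hA : A ∈ alg d (S : Set (Vertex k))) : ntr S (trOut T A) = ntr S A := by
  have hu : ∀ i j : T → Fin d, unit T i j ∈ alg d (S : Set (Vertex k)) :=
    unit_mem_alg (by exact_mod_cast h)
  have hd : (d : ℂ) ≠ 0 := NeZero.ne _
  have : ∀ i j : T → Fin d, ntr S (unit T i j * A * unit T j i) = ntr S (unit T j j * A) := by
    intro i j
    rw [ntr_mul_comm (mul_mem (hu i j) hA) (hu j i), ← mul_assoc, unit_mul_unit, if_pos rfl]
  simp only [trOut, map_smul, map_sum, this]
  rw [Finset.sum_const, ← map_sum, ← Finset.sum_mul, sum_unit, one_mul]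
  simp [hd]

theorem ntr_one (S : Finset (Vertex k)) : ntr S (1 : Op d k) = 1 := by
  have hd : (d : ℂ) ≠ 0 := NeZero.ne _
  rw [← map_one (rep S), ntr_rep, Matrix.trace_one]
  simp [hd]

theorem ntr_of_subset {S T : Finset (Vertex k)} (h : S ⊆ T) {A : Op d k}
    (hA : A ∈ alg d (S : Set (Vertex k))) : ntr T A = ntr S A := by
  rw [← ntr_trOut h (alg_mono (by exact_mod_cast h) hA), trOut_eq_ntr hA, map_smul, ntr_one]
  simp

/-- An average of vector states is positive on every bounded operator, not only on `B_S`. This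
allows `hatState` to be defined on infinitely many sites. -/
theorem ntr_nonneg (S : Finset (Vertex k)) {A : Op d k} (hA : 0 ≤ A) : 0 ≤ ntr S A := by
  change 0 ≤ ((d : ℂ) ^ S.card)⁻¹ * ∑ i : S → Fin d, A (ket (patch S i 0)) (patch S i 0)
  refine mul_nonneg (by positivity) (Finset.sum_nonneg fun i _ => ?_)
  rw [← ket_inner]
  exact ((ContinuousLinearMap.nonneg_iff_isPositive A).1 hA).inner_nonneg_right _

end

/-! ### Functional calculus of local observables -/

theorem sqrt_mem_alg {X : Set (Vertex k)} {A : Op d k} (hA : A ∈ alg d X) :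
    CFC.sqrt A ∈ alg d X := by
  by_cases h : 0 ≤ A
  · rw [CFC.sqrt_eq_real_sqrt A h, cfcₙ_eq_cfc]
    exact cfc_mem (𝕜' := ℂ) Real.sqrt hA
  -- Here the square root takes its default value 0.
  · rw [CFC.sqrt_of_not_nonneg h]
    exact zero_mem _

theorem star_sqrt (A : Op d k) : star (CFC.sqrt A) = CFC.sqrt A :=
  (IsSelfAdjoint.of_nonneg (CFC.sqrt_nonneg A)).star_eq

open scoped MatrixOrder Matrix.Norms.L2Operator in
theorem rep_nonneg {S : Finset (Vertex k)} {a : Mat d S} (ha : a.PosSemidef) :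
    0 ≤ (rep S a : Op d k) := by
  obtain ⟨b, rfl⟩ := CStarAlgebra.nonneg_iff_eq_star_mul_self.1 ha.nonneg
  rw [map_mul, map_star]
  exact star_mul_self_nonneg _

/-- On a finite spectrum every function is continuous, so the functional calculus applies even to x
↦ x⁻¹ at 0. -/
theorem finite_spectrum_real [NeZero d] {S : Finset (Vertex k)} {A : Op d k}
    (hA : A ∈ alg d (S : Set (Vertex k))) : (spectrum ℝ A).Finite := by
  obtain ⟨a, rfl⟩ := mem_alg_finset.1 hA
  have h : (spectrum ℂ (rep S a : Op d k)).Finite :=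
    (Matrix.finite_spectrum a).subset (AlgHom.spectrum_apply_subset (rep S) a)
  exact h.preimage (f := algebraMap ℝ ℂ) (by exact Complex.ofReal_injective.injOn)

/-- Self-adjoint observables on finitely many sites have generalized inverses. -/
theorem exists_generalizedInverse [NeZero d] {S : Finset (Vertex k)} {A : Op d k}
    (hA : A ∈ alg d (S : Set (Vertex k))) (hs : IsSelfAdjoint A) :
    ∃ Q ∈ alg d (S : Set (Vertex k)), star Q = Q ∧ Commute A Q ∧ A * Q * A = A := by
  have hfin := finite_spectrum_real hA
  -- With the convention 0⁻¹ = 0, the identity x x⁻¹ x = x holds at 0 too.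
  refine ⟨cfc (fun x : ℝ => x⁻¹) A, cfc_mem (𝕜' := ℂ) _ hA,
    (cfc_predicate (fun x : ℝ => x⁻¹) A).star_eq, ?_, ?_⟩
  · nth_rw 1 [← cfc_id ℝ A]
    exact cfc_commute_cfc _ _ _
  · nth_rw 1 3 4 [← cfc_id ℝ A]
    rw [← cfc_mul _ _ _ (hfin.continuousOn _) (hfin.continuousOn _),
      ← cfc_mul _ _ _ (hfin.continuousOn _) (hfin.continuousOn _)]
    refine cfc_congr fun x _ => ?_
    simp

end QMC

/-! ### Positivity and complete positivity -/

theorem CStarAlgebra.exists_eq_star_mul_self {A : Type*} [CStarAlgebra A] [PartialOrder A]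
    [StarOrderedRing A] {a : A} (h : 0 ≤ a) : ∃ b, a = star b * b :=
  CStarAlgebra.nonneg_iff_eq_star_mul_self.1 h

/-- Injective ⋆-homomorphisms preserve spectra. Thus positivity in a subalgebra with its own
spectral order can be tested in the ambient algebra. -/
theorem StarAlgHom.nonneg_of_map_nonneg {A B : Type*} [CStarAlgebra A] [CStarAlgebra B]
    [PartialOrder A] [StarOrderedRing A] [PartialOrder B] [StarOrderedRing B]
    (f : A →⋆ₐ[ℂ] B) (hf : Function.Injective f) {a : A} (h : 0 ≤ f a) : 0 ≤ a := by
  have hs : IsSelfAdjoint a := hf (by rw [map_star]; exact (IsSelfAdjoint.of_nonneg h).star_eq)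
  rw [StarOrderedRing.nonneg_iff_spectrum_nonneg (R := ℝ) a hs]
  rw [← hs.map_spectrum_real f hf]
  exact fun x hx => spectrum_nonneg_of_nonneg h hx

theorem eq_zero_of_sum_star_mul_self_eq_zero {A ι : Type*} [CStarAlgebra A] [PartialOrder A]
    [StarOrderedRing A] {s : Finset ι} {f : ι → A} (h : ∑ i ∈ s, star (f i) * f i = 0) {i : ι}
    (hi : i ∈ s) : f i = 0 := by
  rw [Finset.sum_eq_zero_iff_of_nonneg fun i _ => star_mul_self_nonneg (f i)] at h
  exact CStarRing.star_mul_self_eq_zero_iff _ |>.1 (h i hi)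

/-- Entrywise application of a unital ⋆-homomorphism to matrices. -/
def CStarMatrix.mapStarAlgHom {A B : Type*} [CStarAlgebra A] [CStarAlgebra B] {n : Type*}
    [Fintype n] [DecidableEq n] (f : A →⋆ₐ[ℂ] B) : CStarMatrix n n A →⋆ₐ[ℂ] CStarMatrix n n B :=
  { CStarMatrix.mapₙₐ (n := n) (f : A →⋆ₙₐ[ℂ] B) with
    map_one' := by
      ext i j
      by_cases h : i = j <;> simp [CStarMatrix.one_apply, h]
    commutes' := fun c => by
      ext i j
      by_cases h : i = j <;> simp [CStarMatrix.algebraMap_apply, h, AlgHomClass.commutes] }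

/-- A linear map of Kraus form `a ↦ ∑ Vᵢ⋆ a Vᵢ`, with `Vᵢ` in an ambient C⋆-algebra, is completely
positive. -/
theorem CStarMatrix.map_nonneg_of_kraus {A B C ι n : Type*} [CStarAlgebra A] [CStarAlgebra B]
    [CStarAlgebra C] [PartialOrder A] [StarOrderedRing A] [PartialOrder B] [StarOrderedRing B]
    [PartialOrder C] [StarOrderedRing C] [Fintype ι] [Fintype n] [DecidableEq n] (f : A →⋆ₐ[ℂ] C)
    (g : B →⋆ₐ[ℂ] C) (hg : Function.Injective g) (V : ι → C) (φ : A → B)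
    (h : ∀ a, g (φ a) = ∑ i, star (V i) * f a * V i) {M : CStarMatrix n n A} (hM : 0 ≤ M) :
    0 ≤ M.map φ := by
  refine StarAlgHom.nonneg_of_map_nonneg (CStarMatrix.mapStarAlgHom g)
    (CStarMatrix.map_injective hg) ?_
  obtain ⟨N, rfl⟩ := CStarAlgebra.exists_eq_star_mul_self hM
  -- Writing M = N⋆N, the image of M is the sum of X_i⋆X_i, where X_i has entries f(N_lm) V_i.
  have : CStarMatrix.mapStarAlgHom g ((star N * N).map φ) =
      ∑ i, star (CStarMatrix.ofMatrix fun l m => f (N l m) * V i) *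
        (CStarMatrix.ofMatrix fun l m => f (N l m) * V i) := by
    ext l m
    have hsum : ∀ W : ι → CStarMatrix n n C, (∑ i, W i) l m = ∑ i, W i l m := fun W =>
      Matrix.sum_apply l m Finset.univ W
    change g (φ ((star N * N) l m)) = _
    rw [h, hsum]
    refine Finset.sum_congr rfl fun i _ => ?_
    simp only [CStarMatrix.mul_apply, CStarMatrix.star_apply, map_sum, map_mul, map_star,
      Finset.mul_sum, Finset.sum_mul, mul_assoc]
    refine Finset.sum_congr rfl fun x _ => ?_
    change _ = star (f (N x l) * V i) * (f (N x m) * V i)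
    rw [star_mul, mul_assoc]
  exact this ▸ Finset.sum_nonneg fun i _ => star_mul_self_nonneg _

namespace QMC

variable {d k : ℕ}

/-- The completely positive map `a ↦ ∑ Vᵢ⋆ a Vᵢ` between algebras of observables. -/
def krausMap {X Y : Set (Vertex k)} {ι : Type*} [Fintype ι] (V : ι → Op d k)
    (hV : ∀ a ∈ alg d X, ∑ i, star (V i) * a * V i ∈ alg d Y) : alg d X →CP alg d Y where
  toFun a := ⟨∑ i, star (V i) * a * V i, hV a a.2⟩
  map_add' a b := by
    ext1
    simp [mul_add, add_mul, Finset.sum_add_distrib]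
  map_smul' c a := by
    ext1
    simp [Finset.smul_sum]
  map_cstarMatrix_nonneg' _ _ hM :=
    CStarMatrix.map_nonneg_of_kraus (alg d X).subtype (alg d Y).subtype
      Subtype.val_injective V _ (fun _ => rfl) hM

theorem krausMap_apply {X Y : Set (Vertex k)} {ι : Type*} [Fintype ι] (V : ι → Op d k)
    (hV : ∀ a ∈ alg d X, ∑ i, star (V i) * a * V i ∈ alg d Y) (a : alg d X) :
    (krausMap V hV a : Op d k) = ∑ i, star (V i) * a * V i := rfl

/-! ### States -/

/-- Cauchy–Schwarz in the GNS space for the pair 1, a, together with φ(a⋆a) ≤ ‖a‖². This uniform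
bound carries convergence from local observables to their closure. -/
theorem IsState.norm_apply_le {A : Type*} [CStarAlgebra A] {φ : A →ₗ[ℂ] ℂ} (h : IsState φ)
    (a : A) : ‖φ a‖ ≤ ‖a‖ := by
  let _ : PartialOrder A := CStarAlgebra.spectralOrder A
  have _ : StarOrderedRing A := CStarAlgebra.spectralOrderedRing A
  have hpos : ∀ a, 0 ≤ a → 0 ≤ φ a := by
    intro a ha
    obtain ⟨b, rfl⟩ := CStarAlgebra.nonneg_iff_eq_star_mul_self.1 ha
    exact h.nonneg b
  let f : A →ₚ[ℂ] ℂ := PositiveLinearMap.mk₀ φ hpos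
  have hf : f 1 = 1 := h.map_one
  have hcs := norm_inner_le_norm (𝕜 := ℂ) (f.toPreGNS 1) (f.toPreGNS a)
  have h1 : ‖f.toPreGNS 1‖ = 1 := by
    rw [PositiveLinearMap.preGNS_norm_def]
    simp [hf]
  have h2 : ‖f.toPreGNS a‖ ≤ ‖a‖ := by
    rw [PositiveLinearMap.preGNS_norm_def]
    refine Real.sqrt_le_iff.2 ⟨norm_nonneg a, ?_⟩
    have := f.norm_apply_le_of_nonneg (star a * a) (star_mul_self_nonneg a)
    rw [CStarRing.norm_star_mul_self] at this
    refine (Complex.re_le_norm _).trans (this.trans_eq ?_)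
    simp [hf, sq]
  rw [PositiveLinearMap.preGNS_inner_def, h1, one_mul] at hcs
  simp only [PositiveLinearMap.ofPreGNS_toPreGNS, star_one, one_mul] at hcs
  exact hcs.trans h2

/-! ### Geometry of the tree -/

@[simp] theorem length_child (x : Vertex k) (i : Fin k) : (child x i).length = x.length + 1 := by
  simp [child]

theorem mem_children {x y : Vertex k} : y ∈ children x ↔ ∃ i, child x i = y := by
  simp [children]

theorem length_of_mem_children {x y : Vertex k} (h : y ∈ children x) :
    y.length = x.length + 1 := by
  obtain ⟨i, rfl⟩ := mem_children.1 h
  simp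

theorem eq_of_mem_children {x y z : Vertex k} (hx : z ∈ children x) (hy : z ∈ children y) :
    x = y := by
  obtain ⟨i, rfl⟩ := mem_children.1 hx
  obtain ⟨j, hj⟩ := mem_children.1 hy
  exact (List.append_inj' hj rfl).1.symm

theorem nodup_children (x : Vertex k) : (children x).Nodup :=
  (List.nodup_finRange k).map fun i j h => by simpa [child] using h

theorem nodup_level (n : ℕ) : (level k n).Nodup := by
  induction n with
  | zero => simp [level]
  | succ n ih =>
    refine List.nodup_flatMap.2 ⟨fun x _ => nodup_children x, ih.imp fun {x y} hxy => ?_⟩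
    exact fun z hx hy => hxy (eq_of_mem_children hx hy)

/-- A vertex together with its direct successors. -/
def fork (x : Vertex k) : Set (Vertex k) := {y | y = x ∨ y ∈ children x}

theorem disjoint_fork {x y : Vertex k} (h : x ≠ y) (hl : x.length = y.length) :
    Disjoint (fork x) (fork y) := by
  rw [Set.disjoint_left]
  rintro z (rfl | hx) (rfl | hy)
  · exact h rfl
  · have := length_of_mem_children hy
    omega
  · have := length_of_mem_children hx
    omega
  · exact h (eq_of_mem_children hx hy)

/-! ### Localization of the products -/

theorem list_prod_mem_alg {ι : Type*} {X : Set (Vertex k)} {l : List ι} {f : ι → Op d k}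
    (h : ∀ i ∈ l, f i ∈ alg d X) : (l.map f).prod ∈ alg d X :=
  list_prod_mem fun A hA => by
    obtain ⟨i, hi, rfl⟩ := List.mem_map.1 hA
    exact h i hi

theorem site_mem_alg {X : Set (Vertex k)} (h : SiteOps d k) {x : Vertex k} (hx : x ∈ X) :
    site h x ∈ alg d X :=
  rep_mem_alg (by simpa using hx) _

theorem root_mem_alg {X : Set (Vertex k)} (w : Mat d ({[]} : Finset (Vertex k)))
    (hX : [] ∈ X) : root w ∈ alg d X :=
  rep_mem_alg (by simpa using hX) _

theorem succProd_mem_alg {X : Set (Vertex k)} (K : EdgeOps d k) {x : Vertex k}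
    (hx : fork x ⊆ X) : succProd K x ∈ alg d X :=
  list_prod_mem_alg fun i _ => rep_mem_alg (fun y hy => hx (by
    simp only [Finset.coe_insert, Finset.coe_singleton, Set.mem_insert_iff,
      Set.mem_singleton_iff] at hy
    exact hy.imp_right fun h => mem_children.2 ⟨i, h.symm⟩)) _

/-- The product of the `h_y` over the direct successors `y` of `x`. -/
def succSites (h : SiteOps d k) (x : Vertex k) : Op d k :=
  ((List.finRange k).map fun i => site h (child x i)).prod

theorem succSites_mem_alg {X : Set (Vertex k)} (h : SiteOps d k) {x : Vertex k}
    (hx : fork x ⊆ X) : succSites h x ∈ alg d X :=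
  list_prod_mem_alg fun i _ => site_mem_alg h (hx (Or.inr (mem_children.2 ⟨i, rfl⟩)))

/-- The product of the `h_x` over the vertices of level `n`. -/
def levelSites (h : SiteOps d k) (n : ℕ) : Op d k := ((level k n).map (site h)).prod

theorem layer_mem_alg {X : Set (Vertex k)} (K : EdgeOps d k) {n : ℕ}
    (hX : ∀ x : Vertex k, x.length = n ∨ x.length = n + 1 → x ∈ X) : layer K n ∈ alg d X := by
  refine list_prod_mem_alg fun x hx => succProd_mem_alg K ?_
  have hx' := mem_level.1 hx
  rintro y (rfl | hy)
  · exact hX _ (Or.inl hx')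
  · exact hX _ (Or.inr (by rw [length_of_mem_children hy, hx']))

theorem levelSites_mem_alg {X : Set (Vertex k)} (h : SiteOps d k) {n : ℕ}
    (hX : ∀ x : Vertex k, x.length = n → x ∈ X) : levelSites h n ∈ alg d X :=
  list_prod_mem_alg fun x hx => site_mem_alg h (hX x (mem_level.1 hx))

theorem sqrtBdry_mem_alg {X : Set (Vertex k)} (h : SiteOps d k) {n : ℕ}
    (hX : ∀ x : Vertex k, x.length = n → x ∈ X) : sqrtBdry h n ∈ alg d X :=
  list_prod_mem_alg fun x hx => sqrt_mem_alg (site_mem_alg h (hX x (mem_level.1 hx)))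

/-- The product `K_{[0,1]} ⋯ K_{[n-1,n]}`. -/
def layers (K : EdgeOps d k) (n : ℕ) : Op d k := ((List.range n).map fun m => layer K m).prod

theorem layers_zero (K : EdgeOps d k) : layers K 0 = 1 := rfl

theorem layers_succ (K : EdgeOps d k) (n : ℕ) : layers K (n + 1) = layers K n * layer K n := by
  simp [layers, List.range_succ]

theorem layers_mem_alg {X : Set (Vertex k)} (K : EdgeOps d k) {n : ℕ}
    (hX : (ball k n : Set (Vertex k)) ⊆ X) : layers K n ∈ alg d X :=
  list_prod_mem_alg fun m hm => layer_mem_alg K fun x hx => hX (mem_ball.2 (by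
    have := List.mem_range.1 hm
    omega))

theorem succProdStar_eq (K : EdgeOps d k) (x : Vertex k) :
    succProdStar K x = star (succProd K x) := by
  have : ∀ l : List (Fin k), (l.reverse.map fun i => star (edge K x i)).prod =
      star (l.map fun i => edge K x i).prod := by
    intro l
    induction l with
    | nil => simp
    | cons i l ih => simp [← ih]
  exact this _

/-- Lexicographic order lists the successors of each vertex consecutively, so grouping by parent
needs no commutation. -/
theorem levelSites_succ (h : SiteOps d k) (n : ℕ) :
    levelSites h (n + 1) = ((level k n).map (succSites h)).prod := by
  have : ∀ l : List (Vertex k), ((l.flatMap children).map (site h)).prod =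
      (l.map (succSites h)).prod := by
    intro l
    induction l with
    | nil => simp
    | cons x l ih =>
      rw [List.flatMap_cons, List.map_append, List.prod_append, ih, List.map_cons, List.prod_cons]
      simp [children, succSites, Function.comp_def]
  exact this _

/-! ### Integrating out one layer -/

section

variable [NeZero d]

theorem sqrtBdry_mul_star (h : SiteOps d k) (hh : ∀ x, (h x).PosSemidef) (n : ℕ) :
    sqrtBdry h n * star (sqrtBdry h n) = levelSites h n := by
  have : ∀ l : List (Vertex k), l.Nodup → (l.map fun x => CFC.sqrt (site h x)).prod *
      star (l.map fun x => CFC.sqrt (site h x)).prod = (l.map (site h)).prod := by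
    intro l hl
    induction l with
    | nil => simp
    | cons x l ih =>
      obtain ⟨hx, hl⟩ := List.nodup_cons.1 hl
      have hc : Commute (CFC.sqrt (site h x)) (l.map (site h)).prod :=
        commute_of_disjoint (X := {x}) (Y := {y | y ∈ l}) (by simpa using hx)
          (sqrt_mem_alg (site_mem_alg h rfl)) (list_prod_mem_alg fun y hy => site_mem_alg h hy)
      rw [List.map_cons, List.prod_cons, star_mul, star_sqrt, List.map_cons, List.prod_cons,
        ← mul_assoc, mul_assoc _ _ (star _), ih hl, mul_assoc, ← hc.eq, ← mul_assoc,
        CFC.sqrt_mul_sqrt_self (site h x) (rep_nonneg (hh x))]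
  exact this _ (nodup_level n)

/-- The boundary condition is harmonic: one layer can be integrated out. -/
theorem ntr_layer {K : EdgeOps d k} {h : SiteOps d k}
    (hcons : ∀ x : Vertex k, trOut (children x).toFinset
      (succProd K x * succSites h x * succProdStar K x) = site h x)
    {n : ℕ} {S : Finset (Vertex k)} (hS : ball k (n + 1) ⊆ S) {A : Op d k}
    (hA : A ∈ alg d (ball k n : Set (Vertex k))) :
    ntr S (A * (layer K n * levelSites h (n + 1) * star (layer K n))) =
      ntr S (A * levelSites h n) := by
  rw [levelSites_succ]
  suffices ∀ l : List (Vertex k), l.Nodup → (∀ x ∈ l, x.length = n) →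
      ∀ A ∈ alg d (ball k n : Set (Vertex k)),
      ntr S (A * ((l.map fun x => succProd K x).prod * (l.map (succSites h)).prod *
        star (l.map fun x => succProd K x).prod)) = ntr S (A * (l.map (site h)).prod) from
    this _ (nodup_level n) (fun x hx => mem_level.1 hx) A hA
  intro l hl hn
  -- `A` stays quantified: each vertex treated leaves a factor h_x that is absorbed into it.
  induction l with
  | nil => simp
  | cons x l ih =>
    intro A hA
    obtain ⟨hx, hl⟩ := List.nodup_cons.1 hl
    have hxn : x.length = n := hn x (by simp)
    have hln : ∀ y ∈ l, y.length = n := fun y hy => hn y (by simp [hy])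
    set Y : Set (Vertex k) := ⋃ y ∈ l, fork y with hY
    have hYx : Disjoint (fork x) Y := by
      simp only [hY, Set.disjoint_iUnion_right]
      exact fun y hy => disjoint_fork (fun e => hx (e ▸ hy)) (hxn.trans (hln y hy).symm)
    have hsub : ∀ y ∈ l, fork y ⊆ Y := fun y hy => Set.subset_biUnion_of_mem (u := fork) hy
    have hstar : ∀ y : Vertex k, y.length = n → fork y ⊆ (S : Set (Vertex k)) := by
      rintro y hy z (rfl | hz)
      · exact hS (mem_ball.2 (by omega))
      · exact hS (mem_ball.2 (by rw [length_of_mem_children hz, hy]))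
    have hYS : Y ⊆ S := Set.iUnion₂_subset fun y hy => hstar y (hln y hy)
    set Kl := (l.map fun x => succProd K x).prod
    set Hl := (l.map (succSites h)).prod
    have hKl : Kl ∈ alg d Y := list_prod_mem_alg fun y hy => succProd_mem_alg K (hsub y hy)
    have hHl : Hl ∈ alg d Y := list_prod_mem_alg fun y hy => succSites_mem_alg h (hsub y hy)
    have hKx : succProd K x ∈ alg d (fork x) := succProd_mem_alg K subset_rfl
    have hHx : succSites h x ∈ alg d (fork x) := succSites_mem_alg h subset_rfl
    set R := Kl * Hl * star Kl with hR
    have hRY : R ∈ alg d Y := mul_mem (mul_mem hKl hHl) (star_mem hKl)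
    have hG : succProd K x * succSites h x * succProdStar K x ∈ alg d (fork x) := by
      rw [succProdStar_eq]
      exact mul_mem (mul_mem hKx hHx) (star_mem hKx)
    -- The other vertices act on disjoint forks, so the factors belonging to x can be collected in
    -- front of theirs.
    have e : succProd K x * Kl * (succSites h x * Hl) * star (succProd K x * Kl) =
        succProd K x * succSites h x * succProdStar K x * R := by
      have c1 : Kl * succSites h x = succSites h x * Kl := (commute_of_disjoint hYx hHx hKl).eq.symm
      have c2 : R * star (succProd K x) = star (succProd K x) * R :=
        (commute_of_disjoint hYx (star_mem hKx) hRY).eq.symm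
      rw [succProdStar_eq, star_mul, mul_assoc (_ * succSites h x), ← c2]
      simp only [hR, mul_assoc]
      rw [← mul_assoc Kl (succSites h x), c1, mul_assoc]
    have hC : ((children x).toFinset : Set (Vertex k)) ⊆ fork x := fun y hy =>
      Or.inr (by simpa using hy)
    have hAC : Disjoint (ball k n : Set (Vertex k)) ((children x).toFinset : Set (Vertex k)) := by
      rw [Set.disjoint_left]
      intro y hy hy'
      have h1 := mem_ball.1 (Finset.mem_coe.1 hy)
      have h2 := length_of_mem_children (x := x) (y := y) (by simpa using hy')
      omega
    have hball : (ball k n : Set (Vertex k)) ⊆ S :=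
      (ball_mono n.le_succ).trans (Finset.coe_subset.2 hS)
    simp only [List.map_cons, List.prod_cons]
    -- Read backwards from the right-hand side: tracing out the successors of x leaves `A` and `R`
    -- untouched and turns the factor at x into h_x.
    rw [e, ← mul_assoc A, ← mul_assoc A (site h x), ← ih hl hln _
      (mul_mem hA (site_mem_alg h (mem_ball.2 hxn.le))), ← hcons x,
      ← trOut_mul_left hAC hA, ← trOut_mul_right (hYx.symm.mono_right hC) hRY, ntr_trOut]
    · exact Finset.coe_subset.1 (hC.trans (hstar x hxn))
    · exact mul_mem (mul_mem (alg_mono hball hA) (alg_mono (hstar x hxn) hG)) (alg_mono hYS hRY)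

end

/-! ### Kraus form of the transition maps -/

/-- The Kraus operators of the partial trace over `S`. -/
def trKraus (S : Finset (Vertex k)) (p : (S → Fin d) × (S → Fin d)) : Op d k :=
  (((Real.sqrt ((d : ℝ) ^ S.card))⁻¹ : ℝ) : ℂ) • unit S p.1 p.2

theorem trOut_eq_sum (S : Finset (Vertex k)) (A : Op d k) :
    trOut S A = ∑ p, star (trKraus S p) * A * trKraus S p := by
  have hc : (((Real.sqrt ((d : ℝ) ^ S.card))⁻¹ : ℝ) : ℂ) * ((Real.sqrt ((d : ℝ) ^ S.card))⁻¹ : ℝ) =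
      ((d : ℂ) ^ S.card)⁻¹ := by
    rw [← Complex.ofReal_mul, ← mul_inv, Real.mul_self_sqrt (by positivity)]
    push_cast
    rfl
  rw [Fintype.sum_prod_type, trOut, Finset.sum_comm]
  simp only [trKraus, star_smul, star_unit, smul_mul_assoc, mul_smul_comm, smul_smul,
    Complex.star_def, Complex.conj_ofReal, hc, Finset.smul_sum]

theorem trKraus_mem_alg {X : Set (Vertex k)} {S : Finset (Vertex k)}
    (h : (S : Set (Vertex k)) ⊆ X) (p : (S → Fin d) × (S → Fin d)) : trKraus S p ∈ alg d X :=
  StarSubalgebra.smul_mem _ (unit_mem_alg h _ _) _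

theorem trOut_nonneg (S : Finset (Vertex k)) {A : Op d k} (hA : 0 ≤ A) : 0 ≤ trOut S A := by
  rw [trOut_eq_sum]
  exact Finset.sum_nonneg fun p _ => star_left_conjugate_nonneg hA _

theorem weight_nonneg (K : EdgeOps d k) {w : Mat d ({[]} : Finset (Vertex k))}
    (hw : w.PosSemidef) (n : ℕ) : 0 ≤ weight K w n := by
  induction n with
  | zero => exact rep_nonneg hw
  | succ n ih => exact trOut_nonneg _ (star_left_conjugate_nonneg ih _)

/-- The square root of the weight `ρ_n`. -/
def sqrtWeight (K : EdgeOps d k) (w : Mat d ({[]} : Finset (Vertex k))) (n : ℕ) : Op d k :=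
  CFC.sqrt (weight K w n)

theorem star_sqrtWeight (K : EdgeOps d k) (w : Mat d ({[]} : Finset (Vertex k))) (n : ℕ) :
    star (sqrtWeight K w n) = sqrtWeight K w n :=
  star_sqrt _

theorem sqrtWeight_mul_self (K : EdgeOps d k) {w : Mat d ({[]} : Finset (Vertex k))}
    (hw : w.PosSemidef) (n : ℕ) : sqrtWeight K w n * sqrtWeight K w n = weight K w n :=
  CFC.sqrt_mul_sqrt_self _ (weight_nonneg K hw n)

/-- The Kraus operators of `a ↦ T_{n+1}(ρ_n^{1/2} a ρ_n^{1/2})`. -/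
def transitionKraus (K : EdgeOps d k) (w : Mat d ({[]} : Finset (Vertex k))) (n : ℕ)
    (p : (sphere k n → Fin d) × (sphere k n → Fin d)) : Op d k :=
  sqrtWeight K w n * layer K n * trKraus (sphere k n) p

theorem transition_conj_sqrtWeight (K : EdgeOps d k) (w : Mat d ({[]} : Finset (Vertex k)))
    (n : ℕ) (A : Op d k) :
    transition K n (sqrtWeight K w n * A * sqrtWeight K w n) =
      ∑ p, star (transitionKraus K w n p) * A * transitionKraus K w n p := by
  rw [transition, trOut_eq_sum]
  simp only [transitionKraus, star_mul, star_sqrtWeight, mul_assoc]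

section

variable [NeZero d]

theorem transition_mem_alg {K : EdgeOps d k} {n : ℕ} {X : Set (Vertex k)}
    (hX : ∀ x : Vertex k, x.length = n ∨ x.length = n + 1 → x ∈ X) {A : Op d k}
    (hA : A ∈ alg d X) : transition K n A ∈ alg d (X \ sphere k n) :=
  trOut_mem_alg (mul_mem (mul_mem (star_mem (layer_mem_alg K hX)) hA) (layer_mem_alg K hX))

theorem weight_mem_alg (K : EdgeOps d k) (w : Mat d ({[]} : Finset (Vertex k))) (n : ℕ) :
    weight K w n ∈ alg d (sphere k n : Set (Vertex k)) := by
  induction n with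
  | zero => exact root_mem_alg w (by simp [mem_sphere])
  | succ n ih =>
    have := transition_mem_alg (K := K) (X := {x | x.length = n ∨ x.length = n + 1})
      (fun x hx => hx) (alg_mono (fun x hx => Or.inl (mem_sphere.1 hx)) ih)
    refine alg_mono ?_ this
    rintro x ⟨hx | hx, hx'⟩
    · exact absurd (mem_sphere.2 hx) hx'
    · exact mem_sphere.2 hx

theorem sqrtWeight_mem_alg {X : Set (Vertex k)} (K : EdgeOps d k)
    (w : Mat d ({[]} : Finset (Vertex k))) {n : ℕ} (hX : ∀ x : Vertex k, x.length = n → x ∈ X) :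
    sqrtWeight K w n ∈ alg d X :=
  alg_mono (fun x hx => hX x (mem_sphere.1 hx)) (sqrt_mem_alg (weight_mem_alg K w n))

/-! ### Support and kernel of the weights -/

theorem exists_weightInv (K : EdgeOps d k) (w : Mat d ({[]} : Finset (Vertex k))) (n : ℕ) :
    ∃ Q ∈ alg d (sphere k n : Set (Vertex k)), star Q = Q ∧ Commute (sqrtWeight K w n) Q ∧
      sqrtWeight K w n * Q * sqrtWeight K w n = sqrtWeight K w n :=
  exists_generalizedInverse (sqrt_mem_alg (weight_mem_alg K w n)) (star_sqrt _)

/-- A generalized inverse of `ρ_n^{1/2}`. -/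
def weightInv (K : EdgeOps d k) (w : Mat d ({[]} : Finset (Vertex k))) (n : ℕ) : Op d k :=
  (exists_weightInv K w n).choose

theorem weightInv_mem_alg {X : Set (Vertex k)} (K : EdgeOps d k)
    (w : Mat d ({[]} : Finset (Vertex k))) {n : ℕ} (hX : ∀ x : Vertex k, x.length = n → x ∈ X) :
    weightInv K w n ∈ alg d X :=
  alg_mono (fun x hx => hX x (mem_sphere.1 hx)) (exists_weightInv K w n).choose_spec.1

theorem star_weightInv (K : EdgeOps d k) (w : Mat d ({[]} : Finset (Vertex k))) (n : ℕ) :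
    star (weightInv K w n) = weightInv K w n :=
  (exists_weightInv K w n).choose_spec.2.1

theorem weightInv_commute (K : EdgeOps d k) (w : Mat d ({[]} : Finset (Vertex k))) (n : ℕ) :
    Commute (sqrtWeight K w n) (weightInv K w n) :=
  (exists_weightInv K w n).choose_spec.2.2.1

theorem sqrtWeight_mul_weightInv_mul (K : EdgeOps d k) (w : Mat d ({[]} : Finset (Vertex k)))
    (n : ℕ) : sqrtWeight K w n * weightInv K w n * sqrtWeight K w n = sqrtWeight K w n :=
  (exists_weightInv K w n).choose_spec.2.2.2

/-- The projection onto the kernel of `ρ_n`. -/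
def kerProj (K : EdgeOps d k) (w : Mat d ({[]} : Finset (Vertex k))) (n : ℕ) : Op d k :=
  1 - sqrtWeight K w n * weightInv K w n

theorem kerProj_mem_alg {X : Set (Vertex k)} (K : EdgeOps d k)
    (w : Mat d ({[]} : Finset (Vertex k))) {n : ℕ} (hX : ∀ x : Vertex k, x.length = n → x ∈ X) :
    kerProj K w n ∈ alg d X :=
  sub_mem (one_mem _) (mul_mem (sqrtWeight_mem_alg K w hX) (weightInv_mem_alg K w hX))

theorem star_kerProj (K : EdgeOps d k) (w : Mat d ({[]} : Finset (Vertex k))) (n : ℕ) :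
    star (kerProj K w n) = kerProj K w n := by
  rw [kerProj, star_sub, star_one, star_mul, star_weightInv, star_sqrtWeight,
    (weightInv_commute K w n).eq]

theorem kerProj_mul_sqrtWeight (K : EdgeOps d k) (w : Mat d ({[]} : Finset (Vertex k))) (n : ℕ) :
    kerProj K w n * sqrtWeight K w n = 0 := by
  rw [kerProj, sub_mul, one_mul, sqrtWeight_mul_weightInv_mul, sub_self]

theorem sqrtWeight_mul_kerProj (K : EdgeOps d k) (w : Mat d ({[]} : Finset (Vertex k))) (n : ℕ) :
    sqrtWeight K w n * kerProj K w n = 0 := by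
  simpa [star_sqrtWeight, star_kerProj] using congrArg star (kerProj_mul_sqrtWeight K w n)

theorem kerProj_mul_self (K : EdgeOps d k) (w : Mat d ({[]} : Finset (Vertex k))) (n : ℕ) :
    kerProj K w n * kerProj K w n = kerProj K w n := by
  nth_rw 2 [kerProj]
  rw [mul_sub, mul_one, ← mul_assoc, kerProj_mul_sqrtWeight, zero_mul, sub_zero]

/-- The Kraus operators satisfy ∑ V_p⋆ V_p = ρ_{n+1}. Compressed to the kernel of ρ_{n+1} this sum
of positive terms vanishes, so each term does. -/
theorem transitionKraus_mul_kerProj (K : EdgeOps d k) {w : Mat d ({[]} : Finset (Vertex k))}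
    (hw : w.PosSemidef) (n : ℕ) (p : (sphere k n → Fin d) × (sphere k n → Fin d)) :
    transitionKraus K w n p * kerProj K w (n + 1) = 0 := by
  refine eq_zero_of_sum_star_mul_self_eq_zero (s := Finset.univ)
    (f := fun p => transitionKraus K w n p * kerProj K w (n + 1)) ?_ (Finset.mem_univ p)
  have h : ∑ p, star (transitionKraus K w n p) * transitionKraus K w n p =
      sqrtWeight K w (n + 1) * sqrtWeight K w (n + 1) := by
    have := transition_conj_sqrtWeight K w n 1
    simp only [mul_one] at this
    rw [← this, sqrtWeight_mul_self K hw, sqrtWeight_mul_self K hw]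
    rfl
  calc ∑ p, star (transitionKraus K w n p * kerProj K w (n + 1)) *
        (transitionKraus K w n p * kerProj K w (n + 1))
      = kerProj K w (n + 1) * (∑ p, star (transitionKraus K w n p) * transitionKraus K w n p) *
          kerProj K w (n + 1) := by
        simp only [star_mul, star_kerProj, Finset.mul_sum, Finset.sum_mul, mul_assoc]
    _ = 0 := by rw [h, ← mul_assoc, kerProj_mul_sqrtWeight, zero_mul, zero_mul]

theorem kerProj_mul_transition (K : EdgeOps d k) {w : Mat d ({[]} : Finset (Vertex k))}
    (hw : w.PosSemidef) (n : ℕ) (A : Op d k) :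
    kerProj K w (n + 1) * transition K n (sqrtWeight K w n * A * sqrtWeight K w n) = 0 := by
  rw [transition_conj_sqrtWeight, Finset.mul_sum]
  refine Finset.sum_eq_zero fun p _ => ?_
  have := congrArg star (transitionKraus_mul_kerProj K hw n p)
  rw [star_mul, star_kerProj, star_zero] at this
  rw [← mul_assoc, ← mul_assoc, this, zero_mul, zero_mul]

theorem transition_mul_kerProj (K : EdgeOps d k) {w : Mat d ({[]} : Finset (Vertex k))}
    (hw : w.PosSemidef) (n : ℕ) (A : Op d k) :
    transition K n (sqrtWeight K w n * A * sqrtWeight K w n) * kerProj K w (n + 1) = 0 := by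
  rw [transition_conj_sqrtWeight, Finset.sum_mul]
  exact Finset.sum_eq_zero fun p _ => by
    rw [mul_assoc, transitionKraus_mul_kerProj K hw, mul_zero]

/-! ### The quasi-conditional expectations -/

/-- The Kraus operators of the quasi-conditional expectations: those of the normalized transition
map on the support of the weight, and of the partial trace on its kernel. -/
def condExpKraus (K : EdgeOps d k) (w : Mat d ({[]} : Finset (Vertex k))) (n : ℕ) :
    ((sphere k n → Fin d) × (sphere k n → Fin d)) ⊕
      ((sphere k n → Fin d) × (sphere k n → Fin d)) → Op d k :=
  Sum.elim (fun p => transitionKraus K w n p * weightInv K w (n + 1))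
    (fun p => trKraus (sphere k n) p * kerProj K w (n + 1))

theorem sum_condExpKraus (K : EdgeOps d k) (w : Mat d ({[]} : Finset (Vertex k))) (n : ℕ)
    (A : Op d k) :
    ∑ p, star (condExpKraus K w n p) * A * condExpKraus K w n p =
      weightInv K w (n + 1) * transition K n (sqrtWeight K w n * A * sqrtWeight K w n) *
          weightInv K w (n + 1) +
        kerProj K w (n + 1) * trOut (sphere k n) A * kerProj K w (n + 1) := by
  rw [transition_conj_sqrtWeight, trOut_eq_sum]
  simp only [Fintype.sum_sum_type, condExpKraus, Sum.elim_inl, Sum.elim_inr, star_mul,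
    star_weightInv, star_kerProj, Finset.mul_sum, Finset.sum_mul, mul_assoc]

theorem condExpKraus_mem_alg {X : Set (Vertex k)} (K : EdgeOps d k)
    (w : Mat d ({[]} : Finset (Vertex k))) {n : ℕ}
    (hX : ∀ x : Vertex k, x.length = n ∨ x.length = n + 1 → x ∈ X)
    (p : ((sphere k n → Fin d) × (sphere k n → Fin d)) ⊕
      ((sphere k n → Fin d) × (sphere k n → Fin d))) : condExpKraus K w n p ∈ alg d X := by
  have hS : (sphere k n : Set (Vertex k)) ⊆ X := fun x hx => hX x (Or.inl (mem_sphere.1 hx))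
  rcases p with p | p
  · exact mul_mem (mul_mem (mul_mem (sqrtWeight_mem_alg K w fun x hx => hX x (Or.inl hx))
      (layer_mem_alg K hX)) (trKraus_mem_alg hS p)) (weightInv_mem_alg K w fun x hx =>
        hX x (Or.inr hx))
  · exact mul_mem (trKraus_mem_alg hS p) (kerProj_mem_alg K w fun x hx => hX x (Or.inr hx))

theorem sum_condExpKraus_mem_alg {X : Set (Vertex k)} (K : EdgeOps d k)
    (w : Mat d ({[]} : Finset (Vertex k))) {n : ℕ}
    (hX : ∀ x : Vertex k, x.length = n ∨ x.length = n + 1 → x ∈ X) {A : Op d k}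
    (hA : A ∈ alg d X) :
    ∑ p, star (condExpKraus K w n p) * A * condExpKraus K w n p ∈ alg d (X \ sphere k n) := by
  have hs : sqrtWeight K w n ∈ alg d X := sqrtWeight_mem_alg K w fun x hx => hX x (Or.inl hx)
  have hS : ∀ x : Vertex k, x.length = n + 1 → x ∈ X \ sphere k n := fun x hx =>
    ⟨hX x (Or.inr hx), fun h => by have := mem_sphere.1 (Finset.mem_coe.1 h); omega⟩
  have hQ := weightInv_mem_alg K w hS
  have hP := kerProj_mem_alg K w hS
  rw [sum_condExpKraus]
  exact add_mem (mul_mem (mul_mem hQ (transition_mem_alg hX (mul_mem (mul_mem hs hA) hs))) hQ)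
    (mul_mem (mul_mem hP (trOut_mem_alg hA)) hP)

theorem tail_sdiff_sphere (n : ℕ) : tail k n \ sphere k n ⊆ tail k (n + 1) := by
  rintro x ⟨hx, hx'⟩
  exact lt_of_le_of_ne hx fun h => hx' (mem_sphere.2 h.symm)

/-- The quasi-conditional expectation `ℰ_{n+1}`. -/
def condExp (K : EdgeOps d k) (w : Mat d ({[]} : Finset (Vertex k))) (n : ℕ) :
    alg d (tail k n) →CP alg d (tail k (n + 1)) :=
  krausMap (condExpKraus K w n) fun _ hA => alg_mono (tail_sdiff_sphere n)
    (sum_condExpKraus_mem_alg K w (by rintro x (hx | hx) <;> simp [tail, hx]) hA)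

theorem condExp_mem_alg {X : Set (Vertex k)} (K : EdgeOps d k)
    (w : Mat d ({[]} : Finset (Vertex k))) {n : ℕ}
    (hX : ∀ x : Vertex k, x.length = n ∨ x.length = n + 1 → x ∈ X) {a : alg d (tail k n)}
    (ha : (a : Op d k) ∈ alg d X) : (condExp K w n a : Op d k) ∈ alg d (X \ sphere k n) :=
  sum_condExpKraus_mem_alg K w hX ha

theorem condExp_nonneg (K : EdgeOps d k) (w : Mat d ({[]} : Finset (Vertex k))) (n : ℕ)
    {a : alg d (tail k n)} (ha : 0 ≤ (a : Op d k)) : 0 ≤ (condExp K w n a : Op d k) :=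
  Finset.sum_nonneg fun _ _ => star_left_conjugate_nonneg ha _

/-- With P the kernel projection, the first term of the expectation becomes (1 - P) t (1 - P), equal
to t because t vanishes on the kernel; the second term is killed by ρ_{n+1}^{1/2} P = 0. -/
theorem sqrtWeight_conj_condExp (K : EdgeOps d k) {w : Mat d ({[]} : Finset (Vertex k))}
    (hw : w.PosSemidef) (n : ℕ) (a : alg d (tail k n)) :
    sqrtWeight K w (n + 1) * (condExp K w n a : Op d k) * sqrtWeight K w (n + 1) =
      transition K n (sqrtWeight K w n * (a : Op d k) * sqrtWeight K w n) := by
  rw [condExp, krausMap_apply, sum_condExpKraus]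
  have h1 : sqrtWeight K w (n + 1) * weightInv K w (n + 1) = 1 - kerProj K w (n + 1) := by
    rw [kerProj, sub_sub_cancel]
  have h2 := (weightInv_commute K w (n + 1)).eq.symm.trans h1
  set t := transition K n (sqrtWeight K w n * (a : Op d k) * sqrtWeight K w n)
  calc _ = sqrtWeight K w (n + 1) * weightInv K w (n + 1) * t *
          (weightInv K w (n + 1) * sqrtWeight K w (n + 1)) +
        sqrtWeight K w (n + 1) * kerProj K w (n + 1) * trOut (sphere k n) (a : Op d k) *
          (kerProj K w (n + 1) * sqrtWeight K w (n + 1)) := by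
        simp only [mul_add, add_mul, mul_assoc]
    _ = t := by
      rw [h1, h2, sqrtWeight_mul_kerProj, zero_mul, zero_mul, add_zero, sub_mul, one_mul,
        kerProj_mul_transition K hw, sub_zero, mul_sub, mul_one, transition_mul_kerProj K hw,
        sub_zero]

/-- The two terms send 1 to 1 - P and to P respectively. For the module property, the Kraus
operators sit on levels n and n + 1 and so commute with observables of level at least n + 2. -/
theorem isQuasiCondExp_condExp (K : EdgeOps d k) {w : Mat d ({[]} : Finset (Vertex k))}
    (hw : w.PosSemidef) (n : ℕ) : IsQuasiCondExp (tail k (n + 2)) (condExp K w n) where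
  subset_left x hx := (Nat.le_succ _).trans hx
  subset_right x hx := (Nat.le_succ _).trans hx
  map_one := by
    ext1
    rw [condExp, krausMap_apply, sum_condExpKraus]
    simp only [OneMemClass.coe_one, mul_one]
    rw [sqrtWeight_mul_self K hw, trOut_one, mul_one, kerProj_mul_self]
    change weightInv K w (n + 1) * weight K w (n + 1) * weightInv K w (n + 1) + _ = _
    rw [← sqrtWeight_mul_self K hw, ← mul_assoc, ← (weightInv_commute K w (n + 1)).eq,
      sqrtWeight_mul_weightInv_mul, kerProj]
    simp
  map_mul c a hc := by
    have hd : Disjoint (tail k (n + 2)) {x | x.length = n ∨ x.length = n + 1} := by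
      rw [Set.disjoint_left]
      rintro x hx (h | h) <;> · simp only [tail, Set.mem_ofPred_eq] at hx; omega
    rw [condExp, krausMap_apply, krausMap_apply, Finset.mul_sum]
    refine Finset.sum_congr rfl fun p _ => ?_
    have := (commute_of_disjoint hd hc
      (star_mem (condExpKraus_mem_alg K w (fun x hx => hx) p))).eq
    rw [← mul_assoc, ← mul_assoc, this]
    simp [mul_assoc]

end

end QMC

theorem StarSubalgebra.val_inclusion {A : Type*} [Ring A] [StarRing A] [Algebra ℂ A]
    [StarModule ℂ A] {S T : StarSubalgebra ℂ A} (h : S ≤ T) (a : S) :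
    (StarSubalgebra.inclusion h a : A) = a := rfl

theorem StarSubalgebra.norm_sub_eq {A : Type*} [CStarAlgebra A] (S : StarSubalgebra ℂ A)
    (a b : S) : ‖a - b‖ = ‖(a : A) - b‖ := rfl

namespace QMC

variable {d k : ℕ}

/-! ### Limits of compatible local states -/

theorem coe_incl {X Y : Set (Vertex k)} (h : X ⊆ Y) (A : alg d X) :
    (incl h A : Op d k) = (A : Op d k) :=
  StarSubalgebra.val_inclusion (alg_mono h) A

theorem incl_incl {X Y Z : Set (Vertex k)} (h : X ⊆ Y) (h' : Y ⊆ Z) (A : alg d X) :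
    incl h' (incl h A) = incl (h.trans h') A := by
  ext1
  rw [coe_incl, coe_incl, coe_incl]

theorem incl_self {X : Set (Vertex k)} (h : X ⊆ X) (A : alg d X) : incl h A = A := by
  ext1
  rw [coe_incl]

theorem exists_norm_sub_incl_lt [NeZero d] (A : QuasiLocal d k) {ε : ℝ} (hε : 0 < ε) :
    ∃ (m : ℕ) (B : alg d (ball k m : Set (Vertex k))), ‖A - incl (Set.subset_univ _) B‖ < ε := by
  have hA : (A : Op d k) ∈ closure (localAlg d (Set.univ : Set (Vertex k)) : Set (Op d k)) := by
    rw [← StarSubalgebra.topologicalClosure_coe, ← alg_eq_topologicalClosure_localAlg]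
    exact A.2
  obtain ⟨B, ⟨S, -, hB⟩, hAB⟩ := Metric.mem_closure_iff.1 hA ε hε
  obtain ⟨m, hm⟩ : ∃ m, S ⊆ ball k m :=
    ⟨S.sup List.length, fun x hx => mem_ball.2 (Finset.le_sup (f := List.length) hx)⟩
  have hBm : B ∈ alg d (ball k m : Set (Vertex k)) := by
    obtain ⟨b, rfl⟩ := hB
    exact rep_mem_alg (Finset.coe_subset.2 hm) b
  refine ⟨m, ⟨B, hBm⟩, ?_⟩
  rw [StarSubalgebra.norm_sub_eq, coe_incl, ← dist_eq_norm]
  exact hAB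

/-- One chosen sequence of extending states produces the limit, and the same density estimate
compares it with any other sequence of extensions. -/
theorem exists_isWeakStarLimit [NeZero d]
    (f : ∀ n : ℕ, alg d (ball k n : Set (Vertex k)) →ₗ[ℂ] ℂ)
    (hf : ∀ n A, f (n + 1) (incl (ball_mono n.le_succ) A) = f n A)
    (ψ : ℕ → QuasiLocal d k →ₗ[ℂ] ℂ) (hψ : ∀ n, IsState (ψ n))
    (hψf : ∀ n A, ψ n (incl (Set.subset_univ _) A) = f n A) :
    ∃ φ : QuasiLocal d k →ₗ[ℂ] ℂ, IsState φ ∧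
      (∀ A, Filter.Tendsto (fun n => ψ n A) Filter.atTop (nhds (φ A))) ∧
      IsWeakStarLimit f φ ∧
      ∀ φ' : QuasiLocal d k →ₗ[ℂ] ℂ, IsWeakStarLimit f φ' → φ' = φ := by
  have hle : ∀ m n (h : m ≤ n) A, f n (incl (ball_mono h) A) = f m A := by
    intro m n h A
    induction n, h using Nat.le_induction with
    | base => rw [incl_self]
    | succ n h ih => rw [← ih, ← hf n, incl_incl]
  have hloc : ∀ {θ : ℕ → QuasiLocal d k →ₗ[ℂ] ℂ},
      (∀ n A, θ n (incl (Set.subset_univ _) A) = f n A) →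
      ∀ m n, m ≤ n → ∀ A, θ n (incl (Set.subset_univ _) A) = f m A := by
    intro θ hθ m n h A
    rw [← hle m n h, ← hθ n, incl_incl]
  -- From index N on, all extensions agree on the observables of Λ_N. Taking θ = η gives the Cauchy
  -- property; taking θ ≠ η gives independence of the extension.
  have hdiff : ∀ {θ η : ℕ → QuasiLocal d k →ₗ[ℂ] ℂ}, (∀ n, IsState (θ n)) →
      (∀ n, IsState (η n)) → (∀ n A, θ n (incl (Set.subset_univ _) A) = f n A) →
      (∀ n A, η n (incl (Set.subset_univ _) A) = f n A) →
      ∀ (A : QuasiLocal d k) (ε : ℝ), 0 < ε → ∃ N, ∀ m ≥ N, ∀ n ≥ N, ‖θ m A - η n A‖ < ε := by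
    intro θ η hθ hη hθf hηf A ε hε
    obtain ⟨N, B, hB⟩ := exists_norm_sub_incl_lt A (half_pos hε)
    refine ⟨N, fun m hm n hn => ?_⟩
    set B' : QuasiLocal d k := incl (Set.subset_univ _) B
    have e : θ m A - η n A = θ m (A - B') - η n (A - B') := by
      rw [map_sub, map_sub, hloc hθf N m hm, hloc hηf N n hn]
      ring
    calc ‖θ m A - η n A‖ ≤ ‖θ m (A - B')‖ + ‖η n (A - B')‖ := e ▸ norm_sub_le _ _
      _ ≤ ‖A - B'‖ + ‖A - B'‖ := add_le_add ((hθ m).norm_apply_le _) ((hη n).norm_apply_le _)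
      _ < ε := by linarith
  have hlim : ∀ A, ∃ z, Filter.Tendsto (fun n => ψ n A) Filter.atTop (nhds z) := by
    intro A
    refine cauchySeq_tendsto_of_complete (Metric.cauchySeq_iff.2 fun ε hε => ?_)
    obtain ⟨N, hN⟩ := hdiff hψ hψ hψf hψf A ε hε
    exact ⟨N, fun m hm n hn => by rw [dist_eq_norm]; exact hN m hm n hn⟩
  choose φ₀ hφ₀ using hlim
  let φ : QuasiLocal d k →ₗ[ℂ] ℂ :=
    { toFun := φ₀
      map_add' := fun A B => tendsto_nhds_unique (hφ₀ (A + B))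
        (by simpa using (hφ₀ A).add (hφ₀ B))
      map_smul' := fun c A => tendsto_nhds_unique (hφ₀ (c • A))
        (by simpa using (hφ₀ A).const_mul c) }
  have hφ : ∀ A, Filter.Tendsto (fun n => ψ n A) Filter.atTop (nhds (φ A)) := hφ₀
  refine ⟨φ, ⟨?_, fun a => ?_⟩, hφ, ⟨fun m A => ?_, fun θ hθ hθf A => ?_⟩, fun φ' h' => ?_⟩
  · exact tendsto_nhds_unique (hφ 1) (by simp [(hψ _).map_one])
  · exact ge_of_tendsto' (hφ _) fun n => (hψ n).nonneg a
  · have e : φ (incl (Set.subset_univ _) A) = f m A :=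
      tendsto_nhds_unique (hφ _) (tendsto_const_nhds.congr'
        (Filter.eventually_atTop.2 ⟨m, fun n hn => (hloc hψf m n hn A).symm⟩))
    rw [e]
    exact tendsto_const_nhds.congr fun n => (hle m (m + n) (Nat.le_add_right m n) A).symm
  · refine (hφ A).congr_dist ?_
    rw [Metric.tendsto_atTop]
    intro ε hε
    obtain ⟨N, hN⟩ := hdiff hψ hθ hψf hθf A ε hε
    refine ⟨N, fun n hn => ?_⟩
    rw [Real.dist_0_eq_abs, abs_of_nonneg dist_nonneg, dist_eq_norm]
    exact hN n hn n hn
  -- The states ψ are themselves admissible in the second clause of `IsWeakStarLimit`, which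
  -- therefore determines any limit.
  · exact LinearMap.ext fun A => tendsto_nhds_unique (h'.2 ψ hψ hψf A) (hφ A)

/-! ### The states on the tails -/

theorem coe_compose_zero (E : ∀ n : ℕ, alg d (tail k n) →CP alg d (tail k (n + 1)))
    (a : QuasiLocal d k) : (compose E 0 a : Op d k) = (a : Op d k) :=
  coe_incl (fun x _ => Nat.zero_le x.length) a

theorem compose_succ (E : ∀ n : ℕ, alg d (tail k n) →CP alg d (tail k (n + 1))) (n : ℕ)
    (a : QuasiLocal d k) : compose E (n + 1) a = E n (compose E n a) := rfl

/-- The weighted density `K_{[n,n+1]} 𝐡_{n+1} K_{[n,n+1]}⋆` of one layer. -/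
def layerDensity (K : EdgeOps d k) (h : SiteOps d k) (n : ℕ) : Op d k :=
  layer K n * levelSites h (n + 1) * star (layer K n)

theorem layerDensity_mem_alg {K : EdgeOps d k} {h : SiteOps d k} {n : ℕ} {X : Set (Vertex k)}
    (hX : ∀ x : Vertex k, x.length = n ∨ x.length = n + 1 → x ∈ X) :
    layerDensity K h n ∈ alg d X :=
  mul_mem (mul_mem (layer_mem_alg K hX) (levelSites_mem_alg h fun x hx => hX x (Or.inr hx)))
    (star_mem (layer_mem_alg K hX))

/-- The density of the finite-volume functionals, up to the square roots of `w_0`. -/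
def volDensity (K : EdgeOps d k) (h : SiteOps d k) (n : ℕ) : Op d k :=
  layers K n * levelSites h n * star (layers K n)

theorem volDensity_mem_alg (K : EdgeOps d k) (h : SiteOps d k) (n : ℕ) :
    volDensity K h n ∈ alg d (ball k n : Set (Vertex k)) :=
  mul_mem (mul_mem (layers_mem_alg K subset_rfl)
    (levelSites_mem_alg h fun _ hx => mem_ball.2 hx.le)) (star_mem (layers_mem_alg K subset_rfl))

section

variable [NeZero d]

/-- The square root of the density of the state on `B_{W_n ∪ W_{n+1}}`. -/
def hatAmpl (K : EdgeOps d k) (w : Mat d ({[]} : Finset (Vertex k))) (h : SiteOps d k) (n : ℕ) :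
    Op d k :=
  sqrtWeight K w n * layer K n * sqrtBdry h (n + 1)

theorem hatAmpl_mem_alg (K : EdgeOps d k) (w : Mat d ({[]} : Finset (Vertex k))) (h : SiteOps d k)
    (n : ℕ) : hatAmpl K w h n ∈ alg d (ball k (n + 1) : Set (Vertex k)) := by
  refine mul_mem (mul_mem (sqrtWeight_mem_alg K w ?_) (layer_mem_alg K ?_))
    (sqrtBdry_mem_alg h ?_) <;> · simp only [Finset.mem_coe, mem_ball]; omega

/-- The state `φ̂_n` on the observables of level at least `n`. -/
def hatState (K : EdgeOps d k) (w : Mat d ({[]} : Finset (Vertex k))) (h : SiteOps d k) (n : ℕ) :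
    alg d (tail k n) →ₗ[ℂ] ℂ where
  -- `ntr` is tracial only on its own finite set of sites, so positivity for all `a` requires this
  -- symmetric form; cyclicity is used only after restricting to Λ_{n+1}.
  toFun a := ntr (ball k (n + 1)) (star (hatAmpl K w h n) * (a : Op d k) * hatAmpl K w h n)
  map_add' a b := by simp [mul_add, add_mul]
  map_smul' c a := by simp

theorem hatState_nonneg (K : EdgeOps d k) (w : Mat d ({[]} : Finset (Vertex k))) (h : SiteOps d k)
    (n : ℕ) {a : alg d (tail k n)} (ha : 0 ≤ (a : Op d k)) : 0 ≤ hatState K w h n a :=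
  ntr_nonneg _ (star_left_conjugate_nonneg ha _)

variable {K : EdgeOps d k} {w : Mat d ({[]} : Finset (Vertex k))} {h : SiteOps d k}

theorem hatState_apply (hh : ∀ x, (h x).PosSemidef) {n : ℕ} {a : alg d (tail k n)}
    (ha : (a : Op d k) ∈ alg d (ball k (n + 1) : Set (Vertex k))) :
    hatState K w h n a = ntr (ball k (n + 1))
      (sqrtWeight K w n * (a : Op d k) * sqrtWeight K w n * layerDensity K h n) := by
  have hX := hatAmpl_mem_alg K w h n
  have hs : sqrtWeight K w n ∈ alg d (ball k (n + 1) : Set (Vertex k)) :=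
    sqrtWeight_mem_alg K w fun x hx => mem_ball.2 (by omega)
  have hM : layerDensity K h n ∈ alg d (ball k (n + 1) : Set (Vertex k)) :=
    layerDensity_mem_alg fun x hx => mem_ball.2 (by omega)
  have e : hatAmpl K w h n * star (hatAmpl K w h n) =
      sqrtWeight K w n * layerDensity K h n * sqrtWeight K w n := by
    rw [layerDensity, ← sqrtBdry_mul_star h hh]
    simp only [hatAmpl, star_mul, star_sqrtWeight, mul_assoc]
  change ntr (ball k (n + 1)) (star (hatAmpl K w h n) * (a : Op d k) * hatAmpl K w h n) = _
  rw [mul_assoc, ntr_mul_comm (star_mem hX) (mul_mem ha hX), mul_assoc, e, ← mul_assoc,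
    ntr_mul_comm (mul_mem ha (mul_mem hs hM)) hs]
  simp only [mul_assoc]

/-- Duality between the transition map and conjugation by a layer. `Z` avoids W_n, so it enters the
partial trace, which then disappears under the full trace. -/
theorem ntr_transition {n : ℕ} {S : Finset (Vertex k)} (hS : ball k (n + 1) ⊆ S) {A Z : Op d k}
    (hA : A ∈ alg d (S : Set (Vertex k)))
    (hZ : Z ∈ alg d ((S : Set (Vertex k)) ∩ tail k (n + 1))) :
    ntr S (transition K n A * Z) = ntr S (A * (layer K n * Z * star (layer K n))) := by
  have hL : layer K n ∈ alg d (S : Set (Vertex k)) :=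
    layer_mem_alg K fun x hx => hS (mem_ball.2 (by omega))
  have hZ' : Z ∈ alg d (S : Set (Vertex k)) := alg_mono Set.inter_subset_left hZ
  have hd : Disjoint ((S : Set (Vertex k)) ∩ tail k (n + 1)) (sphere k n : Set (Vertex k)) := by
    rw [Set.disjoint_left]
    rintro x ⟨-, hx⟩ hx'
    have h1 := mem_sphere.1 (Finset.mem_coe.1 hx')
    simp only [tail, Set.mem_ofPred_eq] at hx
    omega
  rw [transition, ← trOut_mul_right hd hZ, ntr_trOut, mul_assoc, mul_assoc,
    ntr_mul_comm (star_mem hL) (mul_mem hA (mul_mem hL hZ')), mul_assoc]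
  · exact fun x hx => hS (mem_ball.2 (by rw [mem_sphere.1 hx]; omega))
  · exact mul_mem (mul_mem (mul_mem (star_mem hL) hA) hL) hZ'

section

variable (hcons : ∀ x : Vertex k, trOut (children x).toFinset
  (succProd K x * succSites h x * succProdStar K x) = site h x)

include hcons

theorem ntr_layerDensity {n : ℕ} {A : Op d k} (hA : A ∈ alg d (ball k n : Set (Vertex k))) :
    ntr (ball k (n + 1)) (A * layerDensity K h n) = ntr (ball k n) (A * levelSites h n) := by
  rw [layerDensity, ntr_layer hcons subset_rfl hA, ntr_of_subset
    (Finset.coe_subset.1 (ball_mono n.le_succ))]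
  exact mul_mem hA (levelSites_mem_alg h fun x hx => mem_ball.2 hx.le)

/-- The value does not depend on n: duality moves the last layer from the weight to the boundary
term, where harmonicity absorbs it, down to tr(w_0 h_0). -/
theorem ntr_weight (htr : (w * h []).trace / (d : ℂ) = 1) (n : ℕ) :
    ntr (ball k n) (weight K w n * levelSites h n) = 1 := by
  have hsub : ∀ n, (sphere k n : Set (Vertex k)) ⊆ ball k n := fun n x hx =>
    mem_ball.2 (mem_sphere.1 hx).le
  induction n with
  | zero =>
    have : weight K w 0 * levelSites h 0 = rep ({[]} : Finset (Vertex k)) (w * h []) := by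
      simp [weight, levelSites, level, root, site]
    rw [this, ntr_of_subset (S := {[]}), ntr_rep]
    · simpa using htr
    · simp [mem_ball]
    · exact rep_mem_alg subset_rfl _
  | succ n ih =>
    have hZ : levelSites h (n + 1) ∈
        alg d ((ball k (n + 1) : Set (Vertex k)) ∩ tail k (n + 1)) :=
      levelSites_mem_alg h fun x hx => ⟨mem_ball.2 hx.le, hx.ge⟩
    have hW := alg_mono (hsub n) (weight_mem_alg K w n)
    rw [weight, ntr_transition subset_rfl (alg_mono (ball_mono n.le_succ) hW) hZ]
    exact (ntr_layerDensity hcons hW).trans ih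

theorem isState_hatState (hw : w.PosSemidef) (hh : ∀ x, (h x).PosSemidef)
    (htr : (w * h []).trace / (d : ℂ) = 1) (n : ℕ) : IsState (hatState K w h n) where
  map_one := by
    rw [hatState_apply hh (one_mem _)]
    simp only [OneMemClass.coe_one, mul_one]
    rw [sqrtWeight_mul_self K hw, ntr_layerDensity hcons, ntr_weight hcons htr]
    exact alg_mono (fun x hx => mem_ball.2 (mem_sphere.1 hx).le) (weight_mem_alg K w n)
  nonneg a := hatState_nonneg K w h n (star_mul_self_nonneg (a : Op d k))

/-- Both sides equal tr(T_{n+1}(ρ_n^{1/2} a ρ_n^{1/2}) H_{n+1}): the left by duality, the right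
after integrating out the layer between levels n + 1 and n + 2. -/
theorem hatState_condExp (hw : w.PosSemidef) (hh : ∀ x, (h x).PosSemidef) (n : ℕ)
    (a : alg d (tail k n))
    (ha : (a : Op d k) ∈ alg d {x : Vertex k | x.length = n ∨ x.length = n + 1}) :
    hatState K w h n a = hatState K w h (n + 1) (condExp K w n a) := by
  have hab : (a : Op d k) ∈ alg d (ball k (n + 1) : Set (Vertex k)) :=
    alg_mono (fun x hx => mem_ball.2 (by rcases hx with hx | hx <;> omega)) ha
  have hE : (condExp K w n a : Op d k) ∈ alg d (ball k (n + 1) : Set (Vertex k)) :=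
    alg_mono Set.sdiff_subset (condExp_mem_alg K w (fun x hx => mem_ball.2 (by omega)) hab)
  have hs : ∀ m ≤ n + 1, sqrtWeight K w m ∈ alg d (ball k (n + 1) : Set (Vertex k)) :=
    fun m hm => sqrtWeight_mem_alg K w fun x hx => mem_ball.2 (by omega)
  have hZ : levelSites h (n + 1) ∈
      alg d ((ball k (n + 1) : Set (Vertex k)) ∩ tail k (n + 1)) :=
    levelSites_mem_alg h fun x hx => ⟨mem_ball.2 hx.le, hx.ge⟩
  rw [hatState_apply hh hab, hatState_apply hh (alg_mono (ball_mono (n + 1).le_succ) hE),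
    ntr_layerDensity hcons
      (mul_mem (mul_mem (hs _ le_rfl) hE) (hs _ le_rfl)), sqrtWeight_conj_condExp K hw,
    ntr_transition subset_rfl (mul_mem (mul_mem (hs _ n.le_succ) hab) (hs _ n.le_succ)) hZ]
  rfl

end

/-! ### The composed states -/

theorem compose_condExp_mem_alg {n N : ℕ} (hn : n ≤ N) {a : QuasiLocal d k}
    (ha : (a : Op d k) ∈ alg d (ball k N : Set (Vertex k))) :
    (compose (condExp K w) n a : Op d k) ∈ alg d ((ball k N : Set (Vertex k)) ∩ tail k n) := by
  induction n with
  | zero =>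
    rw [coe_compose_zero]
    exact alg_mono (Set.subset_inter subset_rfl fun x _ => Nat.zero_le x.length) ha
  | succ n ih =>
    rw [compose_succ]
    refine alg_mono ?_ (condExp_mem_alg K w ?_ (ih (by omega)))
    · rw [Set.inter_sdiff_assoc]
      exact Set.inter_subset_inter_right _ (tail_sdiff_sphere n)
    · intro x hx
      refine ⟨mem_ball.2 (by omega), ?_⟩
      change n ≤ x.length
      omega

theorem compose_condExp_nonneg (n : ℕ) {a : QuasiLocal d k} (ha : 0 ≤ (a : Op d k)) :
    0 ≤ (compose (condExp K w) n a : Op d k) := by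
  induction n with
  | zero => rwa [coe_compose_zero]
  | succ n ih =>
    rw [compose_succ]
    exact condExp_nonneg K w n ih

theorem compose_condExp_one (hw : w.PosSemidef) (n : ℕ) :
    compose (condExp K w) n (1 : QuasiLocal d k) = 1 := by
  induction n with
  | zero =>
    ext1
    rw [coe_compose_zero, OneMemClass.coe_one, OneMemClass.coe_one]
  | succ n ih =>
    rw [compose_succ, ih, (isQuasiCondExp_condExp K hw n).map_one]

/-- Each expectation, compressed by the root of the weight, is a transition map, and duality turns
it into one more layer around `Z`. Hence `Z` varies in the induction. -/
theorem ntr_compose_condExp (hw : w.PosSemidef) {n N : ℕ} (hn : n ≤ N) {a : QuasiLocal d k}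
    (ha : (a : Op d k) ∈ alg d (ball k N : Set (Vertex k))) {Z : Op d k}
    (hZ : Z ∈ alg d ((ball k N : Set (Vertex k)) ∩ tail k n)) :
    ntr (ball k N)
        (sqrtWeight K w n * (compose (condExp K w) n a : Op d k) * sqrtWeight K w n * Z) =
      ntr (ball k N) (sqrtWeight K w 0 * (a : Op d k) * sqrtWeight K w 0 *
        (layers K n * Z * star (layers K n))) := by
  induction n generalizing Z with
  | zero => simp only [layers_zero, one_mul, star_one, mul_one, coe_compose_zero]
  | succ n ih =>
    have hs : sqrtWeight K w n ∈ alg d (ball k N : Set (Vertex k)) :=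
      sqrtWeight_mem_alg K w fun x hx => mem_ball.2 (by omega)
    have hc := alg_mono Set.inter_subset_left (compose_condExp_mem_alg (K := K) (w := w)
      (n := n) (by omega) ha)
    have hL : layer K n ∈ alg d ((ball k N : Set (Vertex k)) ∩ tail k n) :=
      layer_mem_alg K fun x hx => ⟨mem_ball.2 (by omega), show n ≤ x.length by omega⟩
    have hsub : (ball k N : Set (Vertex k)) ∩ tail k (n + 1) ⊆
        (ball k N : Set (Vertex k)) ∩ tail k n :=
      Set.inter_subset_inter_right _ fun x hx => (Nat.le_succ n).trans hx
    rw [compose_succ, sqrtWeight_conj_condExp K hw, ntr_transition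
      (Finset.coe_subset.1 (ball_mono hn)) (mul_mem (mul_mem hs hc) hs) hZ,
      ih (by omega) (mul_mem (mul_mem hL (alg_mono hsub hZ)) (star_mem hL)), layers_succ]
    simp only [star_mul, mul_assoc]

theorem finVol_eq (hh : ∀ x, (h x).PosSemidef) (n : ℕ)
    (A : alg d (ball k n : Set (Vertex k))) :
    finVol K w h n A = ntr (ball k (n + 1))
      (sqrtWeight K w 0 * (A : Op d k) * sqrtWeight K w 0 * volDensity K h (n + 1)) := by
  have hs : sqrtWeight K w 0 ∈ alg d (ball k (n + 1) : Set (Vertex k)) :=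
    sqrtWeight_mem_alg K w fun x hx => mem_ball.2 (by omega)
  have hA := alg_mono (ball_mono n.le_succ) A.2
  have hV := volDensity_mem_alg K h (n + 1)
  have e : density K w h (n + 1) =
      sqrtWeight K w 0 * volDensity K h (n + 1) * sqrtWeight K w 0 := by
    rw [volDensity, ← sqrtBdry_mul_star h hh]
    simp only [density, ampl, star_mul, mul_assoc]
    rw [star_sqrt]
    rfl
  rw [finVol_apply, e, mul_assoc, mul_assoc, ntr_mul_comm hs (mul_mem hV (mul_mem hs hA)),
    mul_assoc, ntr_mul_comm hV (mul_mem (mul_mem hs hA) hs)]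

section

variable (hcons : ∀ x : Vertex k, trOut (children x).toFinset
  (succProd K x * succSites h x * succProdStar K x) = site h x)

include hcons

/-- The earlier layers lie in `B_{Λ_n}`, so cyclicity moves them next to `A` and exposes the last
layer to harmonicity. -/
theorem ntr_volDensity_succ {n : ℕ} {A : Op d k}
    (hA : A ∈ alg d (ball k n : Set (Vertex k))) :
    ntr (ball k (n + 1)) (A * volDensity K h (n + 1)) =
      ntr (ball k n) (A * volDensity K h n) := by
  have hP := layers_mem_alg (d := d) K (n := n) subset_rfl
  have hb : ∀ {B : Op d k}, B ∈ alg d (ball k n : Set (Vertex k)) →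
      B ∈ alg d (ball k (n + 1) : Set (Vertex k)) := fun hB => alg_mono (ball_mono n.le_succ) hB
  have hM : layerDensity K h n ∈ alg d (ball k (n + 1) : Set (Vertex k)) :=
    layerDensity_mem_alg fun x hx => mem_ball.2 (by omega)
  have hH : levelSites h n ∈ alg d (ball k n : Set (Vertex k)) :=
    levelSites_mem_alg h fun x hx => mem_ball.2 hx.le
  have e : volDensity K h (n + 1) = layers K n * layerDensity K h n * star (layers K n) := by
    rw [volDensity, layers_succ, layerDensity]
    simp only [star_mul, mul_assoc]
  rw [e, volDensity, ← mul_assoc A, ← mul_assoc A, ← mul_assoc A, ← mul_assoc A,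
    ntr_mul_comm (mul_mem (mul_mem (hb hA) (hb hP)) hM) (hb (star_mem hP)),
    ntr_mul_comm (mul_mem (mul_mem hA hP) hH) (star_mem hP),
    ← mul_assoc, ← mul_assoc, ← mul_assoc, ← mul_assoc, ntr_layerDensity hcons (mul_mem (mul_mem (star_mem hP) hA) hP)]

theorem finVol_eq_of_harmonic (hh : ∀ x, (h x).PosSemidef) (n : ℕ)
    (A : alg d (ball k n : Set (Vertex k))) :
    finVol K w h n A = ntr (ball k n)
      (sqrtWeight K w 0 * (A : Op d k) * sqrtWeight K w 0 * volDensity K h n) := by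
  have hs : sqrtWeight K w 0 ∈ alg d (ball k n : Set (Vertex k)) :=
    sqrtWeight_mem_alg K w fun x hx => mem_ball.2 (by omega)
  rw [finVol_eq hh, ntr_volDensity_succ hcons (mul_mem (mul_mem hs A.2) hs)]

/-- This supplies the extending states to which the limit argument is applied. -/
theorem hatState_compose (hw : w.PosSemidef) (hh : ∀ x, (h x).PosSemidef) (n : ℕ)
    (A : alg d (ball k n : Set (Vertex k))) :
    hatState K w h n (compose (condExp K w) n (incl (Set.subset_univ _) A)) =
      finVol K w h n A := by
  have hA : (incl (Set.subset_univ _) A : Op d k) ∈ alg d (ball k n : Set (Vertex k)) := by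
    rw [coe_incl]
    exact A.2
  have hc := alg_mono Set.inter_subset_left (compose_condExp_mem_alg (K := K) (w := w)
    le_rfl hA)
  have hs : sqrtWeight K w n ∈ alg d (ball k n : Set (Vertex k)) :=
    sqrtWeight_mem_alg K w fun x hx => mem_ball.2 hx.le
  rw [hatState_apply hh (alg_mono (ball_mono n.le_succ) hc),
    ntr_layerDensity hcons (mul_mem (mul_mem hs hc) hs), ntr_compose_condExp hw le_rfl hA
      (levelSites_mem_alg h fun x hx => ⟨mem_ball.2 hx.le, hx.ge⟩),
    finVol_eq_of_harmonic hcons hh, coe_incl, volDensity]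

theorem finVol_succ (hh : ∀ x, (h x).PosSemidef) (n : ℕ)
    (A : alg d (ball k n : Set (Vertex k))) :
    finVol K w h (n + 1) (incl (ball_mono n.le_succ) A) = finVol K w h n A := by
  rw [finVol_eq hh n, finVol_eq_of_harmonic hcons hh, coe_incl]

theorem isState_hatState_compose (hw : w.PosSemidef) (hh : ∀ x, (h x).PosSemidef)
    (htr : (w * h []).trace / (d : ℂ) = 1) (n : ℕ) :
    IsState (hatState K w h n ∘ₗ compose (condExp K w) n) where
  map_one := by
    rw [LinearMap.comp_apply, compose_condExp_one hw, (isState_hatState hcons hw hh htr n).map_one]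
  nonneg a := hatState_nonneg K w h n
    (compose_condExp_nonneg n (star_mul_self_nonneg (a : Op d k)))

end

end

end QMC

end

/-! ### The main theorem -/

theorem theorem3p1 (d k : ℕ) [NeZero d] (hk : 1 ≤ k)
    (K : QMC.EdgeOps d k) (w : QMC.Mat d ({[]} : Finset (QMC.Vertex k))) (h : QMC.SiteOps d k)
    (hw : w.PosSemidef) (hh : ∀ x, (h x).PosSemidef)
    (htr : (w * h []).trace / (d : ℂ) = 1)
    (hcons : ∀ x : QMC.Vertex k,
      QMC.trOut (QMC.children x).toFinset
        (QMC.succProd K x *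
          ((List.finRange k).map fun i => QMC.site h (QMC.child x i)).prod *
          QMC.succProdStar K x) = QMC.site h x) :
    (∀ n, QMC.IsState (QMC.finVol K w h n)) ∧
    (∀ (n : ℕ) (A : QMC.alg d (QMC.ball k n : Set (QMC.Vertex k))),
      QMC.finVol K w h (n + 1) (QMC.incl (QMC.ball_mono n.le_succ) A) = QMC.finVol K w h n A) ∧
    ∃ (φ : QMC.QuasiLocal d k →ₗ[ℂ] ℂ)
      (E : ∀ n : ℕ, QMC.alg d (QMC.tail k n) →CP QMC.alg d (QMC.tail k (n + 1)))
      (φhat : ∀ n : ℕ, QMC.alg d (QMC.tail k n) →ₗ[ℂ] ℂ),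
      QMC.IsForwardQMCWith φ E φhat ∧
      QMC.IsWeakStarLimit (QMC.finVol K w h) φ ∧
      (∀ ψ : QMC.QuasiLocal d k →ₗ[ℂ] ℂ, QMC.IsState ψ →
        QMC.IsWeakStarLimit (QMC.finVol K w h) ψ → ψ = φ) ∧
      ∀ (n : ℕ) (a : QMC.alg d (QMC.tail k n)),
        CFC.sqrt (QMC.weight K w (n + 1)) *
            ((E n a : QMC.alg d (QMC.tail k (n + 1))) : QMC.Op d k) *
            CFC.sqrt (QMC.weight K w (n + 1)) =
          QMC.transition K n
            (CFC.sqrt (QMC.weight K w n) * (a : QMC.Op d k) * CFC.sqrt (QMC.weight K w n)) := by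
  have hψ := QMC.isState_hatState_compose hcons hw hh htr
  have hψf := QMC.hatState_compose hcons hw hh
  have hcompat := QMC.finVol_succ (w := w) hcons hh
  obtain ⟨φ, hφ, hlim, hws, huniq⟩ :=
    QMC.exists_isWeakStarLimit (QMC.finVol K w h) hcompat _ hψ hψf
  refine ⟨fun n => ⟨?_, fun a => ?_⟩, hcompat, φ, QMC.condExp K w, QMC.hatState K w h,
    ⟨hφ, QMC.isQuasiCondExp_condExp K hw, QMC.isState_hatState hcons hw hh htr,
      QMC.hatState_condExp hcons hw hh, hlim⟩, hws, fun ψ _ hψ' => huniq ψ hψ',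
    QMC.sqrtWeight_conj_condExp K hw⟩
  -- Normalization and positivity of the finite-volume functionals are inherited from the states
  -- extending them.
  · rw [← hψf, map_one]
    exact (hψ n).map_one
  · rw [← hψf, map_mul, map_star]
    exact (hψ n).nonneg _
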